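/- Let $\mathscr H$ be a finite-dimensional real Hilbert space, $F:\mathscr H\to 2^{\mathscr H}$ a set-valued operator, $G:\mathscr H\to\mathscr H$ a map, $\eta_F,\eta_G\in\mathbb R$, $L\ge 0$ and $\gamma>0$. An operator $A:\mathscr H\to 2^{\mathscr H}$ is $\eta$-monotone if $\langle z-y,u-w\rangle\ge\eta\|z-y\|^2$ for all $z,y\in\mathscr H$, $u\in A(z)$, $w\in A(y)$, and maximal $\eta$-monotone if moreover its graph is not properly contained in the graph of another $\eta$-monotone operator. Assume that (A) $F$ is maximal $\eta_F$-monotone, $G$ is $\eta_G$-monotone and $L$-Lipschitz continuous, $1+\gamma\eta_F>0$ and $2(\eta_F+\eta_G)+\gamma\eta_F^2-\gamma L^2>0$. Then the resolvent $J_{\gamma F}=(\mathrm{Id}+\gamma F)^{-1}$ is single-valued and defined on all of $\mathscr H$, the operator $B(z)=J_{\gamma F}(z-\gamma G(z))$ has a Lipschitz constant in $(0,1)$, and the inclusion $0\in F(z)+G(z)$ has exactly one solution $z^*$. Put $\Phi(z)=z-B(z)$. For $b_1,b_2,b_3>0$, $p_1\in(0,1)$, $p_2>1$, $p_3\ge 0$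 and $K_p,T_p>0$ consider $$\dot z=-\frac{K_p}{T_p}\,\omega(z)\Phi(z),\qquad \omega(z)=\frac{b_1}{\|\Phi(z)\|^{1-p_1}}+\frac{b_2}{\|\Phi(z)\|^{1-p_2}}+\frac{b_3}{\|\Phi(z)\|^{p_3}}\ \text{ if }\Phi(z)\ne 0,\qquad \omega(z)=0\ \text{ if }\Phi(z)=0. \tag{1}$$ A solution of (1) is a locally absolutely continuous curve $z:[0,\infty)\to\mathscr H$ that satisfies (1) almost everywhere (if $p_3<1$ the right-hand side is continuous and this means a $C^1$ solution). Its settling time $T(z(0))$ is the infimum of all $T\ge 0$ such that $z(t)=z^*$ for all $t\ge T$ ($+\infty$ if there is no such $T$). 1. The point $z^*$ is the only equilibrium of (1); for every initial condition in $\mathscr H$ there is exactly one solution of (1); and $z^*$ is globally fixed-time stable: it is Lyapunov stable, every settling time is finite, and the settling times are bounded uniformly over all initial conditions in $\mathscr H$. 2. Let $c\in(0,1)$ be any Lipschitz constant of $B$, and put $$r_1=\frac{1+p_1}2\in(\tfrac12,1),\quad r_2=\frac{1+p_2}2>1,\quad M_1=2^{\frac{1+p_1}2}\frac{K_p}{T_p}\frac{b_1(1-c)}{(1+c)^{1-p_1}}>0,\quad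 M_2=2^{\frac{1+p_2}2}\frac{K_p}{T_p}(1-c)^{p_2}b_2>0 .$$ Then for every initial condition $$T(z(0))\le\frac1{M_1(1-r_1)}+\frac1{M_2(r_2-1)} .$$ If $r_1=1-\frac1{2\zeta}$ and $r_2=1+\frac1{2\zeta}$ for some $\zeta>1$, then also $$T(z(0))\le\frac{\pi\zeta}{\sqrt{M_1M_2}} .$$ 3. Let $p_3=0$, let $c\in(0,1)$ be any Lipschitz constant of $B$, and choose $$K_p=\frac1{b_3(1-c)(1-p_1)}\ln\!\Big(1+\frac{b_3\,2^{\frac{1-p_1}2}(1+c)^{1-p_1}}{b_1}\Big)+\frac1{b_3(1-c)(p_2-1)}\ln\!\Big(1+\frac{b_3\,2^{\frac{1-p_2}2}(1-c)^{1-p_2}}{b_2}\Big),$$ which is positive. Then for every prescribed $T_p>0$ and every initial condition, $T(z(0))\le T_p$; that is, the solution of (1) satisfies $z(t)=z^*$ for all $t\ge T_p$. -/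

import Mathlib

open MeasureTheory
open scoped NNReal ENNReal Pointwise

namespace InclusionFlow

section Operators

variable {H : Type*} [NormedAddCommGroup H] [InnerProductSpace ℝ H]

/-- `η`-monotonicity of a set-valued operator; `η` may be negative. -/
def IsMonotoneWith (η : ℝ) (F : H → Set H) : Prop :=
  ∀ z y u w : H, u ∈ F z → w ∈ F y → η * ‖z - y‖ ^ 2 ≤ inner ℝ (z - y) (u - w)

/-- Maximal `η`-monotonicity: no `η`-monotone operator has a strictly larger graph. -/
def IsMaximalMonotoneWith (η : ℝ) (F : H → Set H) : Prop :=
  IsMonotoneWith η F ∧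
    ∀ F' : H → Set H, IsMonotoneWith η F' → (∀ z, F z ⊆ F' z) → F' = F

/-- The inclusion `0 ∈ F(z) + G(z)`. -/
def SolvesInclusion (F : H → Set H) (G : H → H) (z : H) : Prop :=
  (0 : H) ∈ F z + {G z}

/-- The set-valued resolvent `(Id + γ F)⁻¹`. -/
def resolventVal (F : H → Set H) (γ : ℝ) (x : H) : Set H :=
  {y | x ∈ ({y} : Set H) + γ • F y}

open Classical in
/-- The resolvent as a map `H → H`: the element of `(Id + γ F)⁻¹ x`
(and `0` at points where this set is empty). -/
noncomputable def resolventMap (F : H → Set H) (γ : ℝ) (x : H) : H :=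
  if h : (resolventVal F γ x).Nonempty then h.some else 0

/-- The forward-backward operator `B(z) = J_{γF}(z - γ G(z))`. -/
noncomputable def forwardBackward (F : H → Set H) (G : H → H) (γ : ℝ) (z : H) : H :=
  resolventMap F γ (z - γ • G z)

/-- The residual `Φ(z) = z - J_{γF}(z - γ G(z))`. -/
noncomputable def residual (F : H → Set H) (G : H → H) (γ : ℝ) (z : H) : H :=
  z - forwardBackward F G γ z

/-- `c ∈ (0,1)` is a Lipschitz constant of the forward-backward operator. -/
def IsContractionConstant (F : H → Set H) (G : H → H) (γ c : ℝ) : Prop :=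
  0 < c ∧ c < 1 ∧
    ∀ x y : H, ‖forwardBackward F G γ x - forwardBackward F G γ y‖ ≤ c * ‖x - y‖

open Classical in
/-- The scalar weight `ω(z)`, which is `0` on the zero set of `Φ`. -/
noncomputable def weight (F : H → Set H) (G : H → H) (γ b₁ b₂ b₃ p₁ p₂ p₃ : ℝ) (z : H) : ℝ :=
  if residual F G γ z = 0 then 0
  else b₁ * (1 / ‖residual F G γ z‖ ^ (1 - p₁)) + b₂ * (1 / ‖residual F G γ z‖ ^ (1 - p₂))
    + b₃ * (1 / ‖residual F G γ z‖ ^ p₃)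

/-- The right-hand side `-(K_p / T_p) ω(z) Φ(z)`. -/
noncomputable def flowField (F : H → Set H) (G : H → H) (γ b₁ b₂ b₃ p₁ p₂ p₃ Kp Tp : ℝ)
    (z : H) : H :=
  -((Kp / Tp) * weight F G γ b₁ b₂ b₃ p₁ p₂ p₃ z) • residual F G γ z

end Operators

section Stability

variable {H : Type*} [NormedAddCommGroup H] [NormedSpace ℝ H]

/-- Global forward solution of `ż = f(z)` on `[0, ∞)` in the sense of Carathéodory, that is,
a locally absolutely continuous curve satisfying the equation almost everywhere, written in
integral form. For continuous `f` these are exactly the `C¹` solutions.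
Values of `z` at negative times play no role. -/
def IsSolution (f : H → H) (z : ℝ → H) : Prop :=
  ∀ t : ℝ, 0 ≤ t → IntervalIntegrable (fun s => f (z s)) volume 0 t ∧
    z t = z 0 + ∫ s in (0 : ℝ)..t, f (z s)

/-- Every initial condition has a global forward solution, and only one. -/
def IsWellPosed (f : H → H) : Prop :=
  (∀ z₀ : H, ∃ z : ℝ → H, IsSolution f z ∧ z 0 = z₀) ∧
    ∀ z y : ℝ → H, IsSolution f z → IsSolution f y → z 0 = y 0 → ∀ t, 0 ≤ t → z t = y t

/-- The settling time of the curve `z` at `zs`: the infimum of the times `T ≥ 0` such that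
`z(t) = zs` for all `t ≥ T`, and `∞` if there is no such time. -/
noncomputable def settlingTime (z : ℝ → H) (zs : H) : ℝ≥0∞ :=
  ⨅ (T : ℝ≥0) (_ : ∀ t : ℝ, (T : ℝ) ≤ t → z t = zs), (T : ℝ≥0∞)

def IsLyapunovStable (f : H → H) (zs : H) : Prop :=
  ∀ ε : ℝ, 0 < ε → ∃ r : ℝ, 0 < r ∧ ∀ z : ℝ → H, IsSolution f z →
    z 0 ∈ Metric.ball zs r → ∀ t : ℝ, 0 ≤ t → z t ∈ Metric.ball zs ε

def IsGloballyFiniteTimeStable (f : H → H) (zs : H) : Prop :=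
  f zs = 0 ∧ IsLyapunovStable f zs ∧
    ∀ z : ℝ → H, IsSolution f z → settlingTime z zs < ∞

def IsGloballyFixedTimeStable (f : H → H) (zs : H) : Prop :=
  IsGloballyFiniteTimeStable f zs ∧
    ∃ Tmax : ℝ≥0, ∀ z : ℝ → H, IsSolution f z → settlingTime z zs ≤ Tmax

end Stability

/-- The explicit gain `K_p` of the predefined-time regime. -/
noncomputable def predefinedGain (c b₁ b₂ b₃ p₁ p₂ : ℝ) : ℝ :=
  1 / (b₃ * (1 - c) * (1 - p₁)) *
      Real.log (1 + b₃ * (2 : ℝ) ^ ((1 - p₁) / 2) * (1 + c) ^ (1 - p₁) / b₁)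
    + 1 / (b₃ * (1 - c) * (p₂ - 1)) *
      Real.log (1 + b₃ * (2 : ℝ) ^ ((1 - p₂) / 2) * (1 - c) ^ (1 - p₂) / b₂)

end InclusionFlow

open InclusionFlow

/-!
Minty's theorem, in its Debrunner–Flor form, makes `J_{γF}` everywhere defined, and assumption (A)
says exactly that the Lipschitz bound this gives for `B` is below `1`; hence `Φ = Id - B` is
Lipschitz and strongly monotone at its unique zero `z*`. Along the flow, `V = ‖z - z*‖² / 2`
therefore satisfies `V' ≤ -(M₁ V ^ r₁ + M₂ V ^ r₂ + N V)`, where the first term brings `V` from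
`1` to `0` and the second one from `∞` to `1` in a bounded time. The flow is singular at `z*`, but
it has the trajectories of the bounded, globally Lipschitz flow `-Φ / (1 + ‖Φ‖)`: existence
follows by changing time along the latter, and uniqueness from the local Lipschitz continuity of
the field away from `z*`, because a solution that has reached `z*` has to remain there.
-/

namespace InclusionFlow

section DebrunnerFlor

variable {H ι : Type*} [NormedAddCommGroup H] [InnerProductSpace ℝ H]

theorem sum_sum_mul_inner_sub_sub [Fintype ι] {w : ι → ℝ} (hw : ∑ i, w i = 1) (a e : ι → H) :
    ∑ i, ∑ j, w i * w j * inner ℝ (a i - a j) (e i - e j) =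
      2 * (∑ i, w i * inner ℝ (a i) (e i) - inner ℝ (∑ i, w i • a i) (∑ i, w i • e i)) := by
  have left : ∑ i, ∑ j, w i * w j * inner ℝ (a i) (e i) = ∑ i, w i * inner ℝ (a i) (e i) := by
    simp only [mul_right_comm _ (w _), ← Finset.mul_sum, hw, mul_one]
  have right : ∑ i, ∑ j, w i * w j * inner ℝ (a j) (e j) = ∑ i, w i * inner ℝ (a i) (e i) := by
    simp only [mul_assoc, ← Finset.mul_sum, ← Finset.sum_mul, hw, one_mul]
  have cross : ∑ i, ∑ j, w i * w j * inner ℝ (a i) (e j) =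
      inner ℝ (∑ i, w i • a i) (∑ i, w i • e i) := by
    rw [sum_inner]
    simp only [inner_sum, real_inner_smul_left, real_inner_smul_right, mul_assoc, mul_left_comm]
  have cross' : ∑ i, ∑ j, w i * w j * inner ℝ (a j) (e i) =
      inner ℝ (∑ i, w i • a i) (∑ i, w i • e i) := by
    rw [Finset.sum_comm, ← cross]
    simp only [mul_comm (w _) (w _)]
  calc ∑ i, ∑ j, w i * w j * inner ℝ (a i - a j) (e i - e j)
      = ∑ i, ∑ j, (w i * w j * inner ℝ (a i) (e i) - w i * w j * inner ℝ (a i) (e j) -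
          w i * w j * inner ℝ (a j) (e i) + w i * w j * inner ℝ (a j) (e j)) := by
        refine Finset.sum_congr rfl fun i _ => Finset.sum_congr rfl fun j _ => ?_
        rw [inner_sub_left, inner_sub_right, inner_sub_right]
        ring
    _ = _ := by
        simp only [Finset.sum_add_distrib, Finset.sum_sub_distrib, left, right, cross, cross']
        ring

theorem sum_mul_inner_le_inner_sum [Fintype ι] {w : ι → ℝ} (hw : w ∈ stdSimplex ℝ ι) {a e : ι → H}
    (h : ∀ i j, inner ℝ (a i - a j) (e i - e j) ≤ 0) :
    ∑ i, w i * inner ℝ (a i) (e i) ≤ inner ℝ (∑ i, w i • a i) (∑ i, w i • e i) := by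
  have hsum : ∑ i, ∑ j, w i * w j * inner ℝ (a i - a j) (e i - e j) ≤ 0 :=
    Finset.sum_nonpos fun i _ => Finset.sum_nonpos fun j _ =>
      mul_nonpos_of_nonneg_of_nonpos (mul_nonneg (hw.1 i) (hw.1 j)) (h i j)
  rw [sum_sum_mul_inner_sub_sub hw.2] at hsum
  linarith

theorem nonpos_of_forall_le_mul {A B : ℝ} (h : ∀ t ∈ Set.Ioc (0 : ℝ) 1, A ≤ t * B) : A ≤ 0 := by
  have hlim : Filter.Tendsto (fun t : ℝ => t * B) (nhdsWithin 0 (Set.Ioi 0)) (nhds 0) := by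
    simpa using (tendsto_nhdsWithin_of_tendsto_nhds (Filter.tendsto_id.mul_const B) :
      Filter.Tendsto (fun t : ℝ => t * B) (nhdsWithin 0 (Set.Ioi 0)) (nhds (0 * B)))
  exact ge_of_tendsto hlim (Filter.eventually_of_mem (Ioc_mem_nhdsGT one_pos) h)

/- The first-order optimality conditions for maximising `∑ wᵢ kᵢ - ‖∑ wᵢ uᵢ‖²` on the simplex. -/
theorem exists_mem_stdSimplex_forall_le [Fintype ι] [Nonempty ι] (k : ι → ℝ) (u : ι → H) :
    ∃ w ∈ stdSimplex ℝ ι, ∀ i,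
      k i ≤ ∑ j, w j * k j + 2 * inner ℝ (∑ j, w j • u j) (u i - ∑ j, w j • u j) := by
  classical
  let g : (ι → ℝ) → ℝ := fun w => ∑ i, w i * k i - ‖∑ i, w i • u i‖ ^ 2
  have hg : Continuous g := by fun_prop
  obtain ⟨w, hw, hmax⟩ := (isCompact_stdSimplex ℝ ι).exists_isMaxOn
    ⟨_, single_mem_stdSimplex ℝ (Classical.arbitrary ι)⟩ hg.continuousOn
  refine ⟨w, hw, fun i => ?_⟩
  set y := ∑ j, w j • u j with hy
  set S := ∑ j, w j * k j with hS
  suffices key : k i - S - 2 * inner ℝ y (u i - y) ≤ 0 by linarith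
  refine nonpos_of_forall_le_mul (B := ‖u i - y‖ ^ 2) fun t ht => ?_
  let w' : ι → ℝ := (1 - t) • w + t • Pi.single i 1
  have hw' : w' ∈ stdSimplex ℝ ι :=
    convex_stdSimplex ℝ ι hw (single_mem_stdSimplex ℝ i) (by linarith [ht.2]) ht.1.le (by ring)
  have hk : ∑ j, w' j * k j = (1 - t) * S + t * k i := by
    simp [w', add_mul, Finset.sum_add_distrib, mul_assoc, ← Finset.mul_sum, hS, Pi.single_apply]
  have hu : ∑ j, w' j • u j = y + t • (u i - y) := by
    have : ∑ j, w' j • u j = (1 - t) • y + t • u i := by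
      simp [w', add_smul, Finset.sum_add_distrib, mul_smul, ← Finset.smul_sum, hy, Pi.single_apply]
    rw [this]
    module
  have hle : g w' ≤ g w := hmax hw'
  simp only [g, hk, hu, ← hy, ← hS, norm_add_sq_real, real_inner_smul_right, norm_smul,
    Real.norm_of_nonneg ht.1.le] at hle
  exact le_of_mul_le_mul_left (by linarith : t * _ ≤ t * (t * ‖u i - y‖ ^ 2)) ht.1

theorem exists_forall_inner_nonneg_of_finite [Finite ι] [Nonempty ι] (a e : ι → H)
    (h : ∀ i j, inner ℝ (a i - a j) (e i - e j) ≤ 0) :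
    ∃ y : H, ∀ i, 0 ≤ inner ℝ (y - a i) (e i - y) := by
  cases nonempty_fintype ι
  obtain ⟨w, hw, hopt⟩ := exists_mem_stdSimplex_forall_le (fun i => inner ℝ (a i) (e i))
    (fun i => (2⁻¹ : ℝ) • (a i + e i))
  set y := ∑ j, w j • (2⁻¹ : ℝ) • (a j + e j) with hy
  refine ⟨y, fun i => ?_⟩
  have hpq : y = (2⁻¹ : ℝ) • (∑ j, w j • a j + ∑ j, w j • e j) := by
    simp only [hy, Finset.smul_sum, smul_add, Finset.sum_add_distrib, smul_comm (w _) (2⁻¹ : ℝ)]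
  have hS : ∑ j, w j * inner ℝ (a j) (e j) ≤ inner ℝ y y := by
    refine (sum_mul_inner_le_inner_sum hw h).trans ?_
    set p := ∑ j, w j • a j
    set q := ∑ j, w j • e j
    have hsq : 0 ≤ inner ℝ (p - q) (p - q) := real_inner_self_nonneg
    rw [hpq]
    simp only [real_inner_smul_left, real_inner_smul_right, inner_add_left, inner_add_right,
      inner_sub_left, inner_sub_right, real_inner_comm p q] at hsq ⊢
    linarith
  have hi := hopt i
  simp only [inner_sub_left, inner_sub_right, inner_add_right, real_inner_smul_right,
    real_inner_comm y (a i)] at hi ⊢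
  linarith

theorem inner_sub_sub_nonneg_iff_mem_closedBall {a e y : H} :
    0 ≤ inner ℝ (y - a) (e - y) ↔ y ∈ Metric.closedBall ((2⁻¹ : ℝ) • (a + e)) (2⁻¹ * ‖e - a‖) := by
  have hn : ‖e - a‖ = ‖(y - a) + (e - y)‖ := by congr 1; abel
  have hd : y - (2⁻¹ : ℝ) • (a + e) = (2⁻¹ : ℝ) • ((y - a) - (e - y)) := by module
  rw [Metric.mem_closedBall, dist_eq_norm, hd, norm_smul, hn, Real.norm_of_nonneg (by norm_num),
    mul_le_mul_iff_right₀ (by norm_num), ← sq_le_sq₀ (norm_nonneg _) (norm_nonneg _),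
    norm_sub_sq_real, norm_add_sq_real]
  constructor <;> intro h <;> linarith

/- Closed balls of `H` are compact for the weak topology, read through the Riesz isomorphism. -/
theorem nonempty_iInter_closedBall [CompleteSpace H] [Nonempty ι] (x : ι → H) (r : ι → ℝ)
    (h : ∀ s : Finset ι, (⋂ i ∈ s, Metric.closedBall (x i) (r i)).Nonempty) :
    (⋂ i, Metric.closedBall (x i) (r i)).Nonempty := by
  classical
  let T : H ≃ₗᵢ⋆[ℝ] StrongDual ℝ H := InnerProductSpace.toDual ℝ H
  let ball : ι → Set (WeakDual ℝ H) := fun i =>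
    WeakDual.toStrongDual ⁻¹' Metric.closedBall (T (x i)) (r i)
  have mem_ball : ∀ i y, y ∈ Metric.closedBall (x i) (r i) ↔
      StrongDual.toWeakDual (T y) ∈ ball i := fun i y => by
    simp [ball]
  let i₀ := Classical.arbitrary ι
  obtain ⟨φ, -, hφ⟩ := (WeakDual.isCompact_closedBall (T (x i₀)) (r i₀)).inter_iInter_nonempty
    ball (fun i => WeakDual.isClosed_closedBall _ _) fun s => by
      obtain ⟨y, hy⟩ := h (insert i₀ s)
      simp only [Set.mem_iInter, Finset.mem_insert, forall_eq_or_imp, mem_ball] at hy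
      exact ⟨_, hy.1, Set.mem_iInter₂.2 hy.2⟩
  refine ⟨T.symm (WeakDual.toStrongDual φ), Set.mem_iInter.2 fun i => (mem_ball i _).2 ?_⟩
  simpa using Set.mem_iInter.1 hφ i

/-- The **Debrunner–Flor** extension lemma. -/
theorem exists_forall_inner_nonneg [CompleteSpace H] (a e : ι → H)
    (h : ∀ i j, inner ℝ (a i - a j) (e i - e j) ≤ 0) :
    ∃ y : H, ∀ i, 0 ≤ inner ℝ (y - a i) (e i - y) := by
  rcases isEmpty_or_nonempty ι with hι | hι
  · exact ⟨0, hι.elim⟩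
  simp only [inner_sub_sub_nonneg_iff_mem_closedBall, ← Set.mem_iInter]
  refine nonempty_iInter_closedBall _ _ fun s => ?_
  rcases s.eq_empty_or_nonempty with rfl | hs
  · simp
  have : Nonempty s := hs.to_subtype
  obtain ⟨y, hy⟩ := exists_forall_inner_nonneg_of_finite (fun i : s => a i) (fun i => e i)
    fun i j => h i j
  exact ⟨y, Set.mem_iInter₂.2 fun i hi => inner_sub_sub_nonneg_iff_mem_closedBall.1 (hy ⟨i, hi⟩)⟩

end DebrunnerFlor

section Resolvent

variable {H : Type*} [NormedAddCommGroup H] [InnerProductSpace ℝ H] {F : H → Set H} {G : H → H}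
  {η γ c : ℝ} {x x' y y' : H}

theorem mem_resolventVal : y ∈ resolventVal F γ x ↔ ∃ w ∈ F y, y + γ • w = x := by
  simp [resolventVal, Set.mem_smul_set, eq_neg_add_iff_add_eq]

theorem IsMaximalMonotoneWith.mem_of_forall (hF : IsMaximalMonotoneWith η F) {w : H}
    (h : ∀ a b, b ∈ F a → η * ‖y - a‖ ^ 2 ≤ inner ℝ (y - a) (w - b)) : w ∈ F y := by
  let F' : H → Set H := fun z => {b | b ∈ F z ∨ (z = y ∧ b = w)}
  have hF' : IsMonotoneWith η F' := by
    rintro z z' b b' (hb | ⟨rfl, rfl⟩) (hb' | ⟨rfl, rfl⟩)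
    · exact hF.1 _ _ _ _ hb hb'
    · have hzb := h _ _ hb
      rwa [norm_sub_rev, ← neg_sub z, ← neg_sub b, inner_neg_neg] at hzb
    · exact h _ _ hb'
    · simp
  rw [← hF.2 F' hF' fun z b hb => Or.inl hb]
  exact Or.inr ⟨rfl, rfl⟩

/-- **Minty's theorem** for `η`-monotone operators. -/
theorem IsMaximalMonotoneWith.exists_mem_resolventVal [CompleteSpace H]
    (hF : IsMaximalMonotoneWith η F) (hγ : 0 < γ) (hη : 0 < 1 + γ * η) (x : H) :
    ∃ y, y ∈ resolventVal F γ x := by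
  let graph := {p : H × H // p.2 ∈ F p.1}
  let d : graph → H := fun p => (1 + γ * η)⁻¹ • (x - p.1.1 - γ • p.1.2)
  have hd : ∀ p, (1 + γ * η) • d p = x - p.1.1 - γ • p.1.2 := fun p => smul_inv_smul₀ hη.ne' _
  obtain ⟨y, hy⟩ := exists_forall_inner_nonneg (fun p : graph => p.1.1) (fun p => p.1.1 + d p) (by
    intro p q
    have hpq := mul_le_mul_of_nonneg_left (hF.1 _ _ _ _ p.2 q.2) hγ.le
    refine nonpos_of_mul_nonpos_right (a := 1 + γ * η) ?_ hη
    have hsub : (1 + γ * η) • (p.1.1 + d p - (q.1.1 + d q)) =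
        (γ * η) • (p.1.1 - q.1.1) - γ • (p.1.2 - q.1.2) := by
      rw [smul_sub, smul_add, smul_add, hd, hd]
      module
    rw [← real_inner_smul_right, hsub, inner_sub_right, real_inner_smul_right,
      real_inner_smul_right, real_inner_self_eq_norm_sq]
    linarith)
  refine ⟨y, mem_resolventVal.2 ⟨γ⁻¹ • (x - y), hF.mem_of_forall fun a b hb => ?_, ?_⟩⟩
  · have hya := mul_nonneg hη.le (hy ⟨(a, b), hb⟩)
    have hsub : (1 + γ * η) • (a + d ⟨(a, b), hb⟩ - y) =
        γ • (γ⁻¹ • (x - y) - b) - (γ * η) • (y - a) := by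
      rw [smul_sub, smul_add, hd, smul_sub γ, smul_inv_smul₀ hγ.ne']
      module
    rw [← real_inner_smul_right, hsub, inner_sub_right, real_inner_smul_right,
      real_inner_smul_right, real_inner_self_eq_norm_sq] at hya
    exact le_of_mul_le_mul_left (by linarith) hγ
  · rw [smul_inv_smul₀ hγ.ne', add_sub_cancel]

theorem IsMonotoneWith.norm_sub_le_of_mem_resolventVal (hF : IsMonotoneWith η F) (hγ : 0 ≤ γ)
    (hy : y ∈ resolventVal F γ x) (hy' : y' ∈ resolventVal F γ x') :
    (1 + γ * η) * ‖y - y'‖ ≤ ‖x - x'‖ := by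
  obtain ⟨w, hw, rfl⟩ := mem_resolventVal.1 hy
  obtain ⟨w', hw', rfl⟩ := mem_resolventVal.1 hy'
  rcases (norm_nonneg (y - y')).eq_or_lt with h0 | h0
  · rw [← h0, mul_zero]
    exact norm_nonneg _
  refine le_of_mul_le_mul_left ?_ h0
  have hmono := mul_le_mul_of_nonneg_left (hF _ _ _ _ hw hw') hγ
  have hsub : y + γ • w - (y' + γ • w') = (y - y') + γ • (w - w') := by module
  calc ‖y - y'‖ * ((1 + γ * η) * ‖y - y'‖)
      ≤ ‖y - y'‖ ^ 2 + γ * inner ℝ (y - y') (w - w') := by linarith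
    _ = inner ℝ (y - y') (y + γ • w - (y' + γ • w')) := by
      rw [hsub, inner_add_right, real_inner_smul_right, real_inner_self_eq_norm_sq]
    _ ≤ _ := real_inner_le_norm _ _

theorem IsMonotoneWith.eq_of_mem_resolventVal (hF : IsMonotoneWith η F) (hγ : 0 ≤ γ)
    (hη : 0 < 1 + γ * η) (hy : y ∈ resolventVal F γ x) (hy' : y' ∈ resolventVal F γ x) :
    y = y' := by
  have h := hF.norm_sub_le_of_mem_resolventVal hγ hy hy'
  rw [sub_self, norm_zero] at h
  exact sub_eq_zero.1 (norm_le_zero_iff.1 (nonpos_of_mul_nonpos_right h hη))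

theorem IsMaximalMonotoneWith.existsUnique_mem_resolventVal [CompleteSpace H]
    (hF : IsMaximalMonotoneWith η F) (hγ : 0 < γ) (hη : 0 < 1 + γ * η) (x : H) :
    ∃! y, y ∈ resolventVal F γ x :=
  existsUnique_of_exists_of_unique (hF.exists_mem_resolventVal hγ hη x) fun _ _ hy hy' =>
    hF.1.eq_of_mem_resolventVal hγ.le hη hy hy'

theorem resolventMap_mem (h : ∃ y, y ∈ resolventVal F γ x) :
    resolventMap F γ x ∈ resolventVal F γ x := by
  have h' : (resolventVal F γ x).Nonempty := h
  rw [resolventMap, dif_pos h']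
  exact h'.some_mem

theorem norm_forward_sub_sq_le {L : ℝ≥0} (hG : IsMonotoneWith η fun z => {G z})
    (hGL : LipschitzWith L G) (hγ : 0 ≤ γ) (x y : H) :
    ‖(x - γ • G x) - (y - γ • G y)‖ ^ 2 ≤ (1 - 2 * γ * η + γ ^ 2 * L ^ 2) * ‖x - y‖ ^ 2 := by
  have hmono := mul_le_mul_of_nonneg_left (hG x y _ _ rfl rfl) hγ
  have hlip := mul_le_mul_of_nonneg_left
    (pow_le_pow_left₀ (norm_nonneg _) (hGL.norm_sub_le x y) 2) (sq_nonneg γ)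
  have hsub : (x - γ • G x) - (y - γ • G y) = (x - y) - γ • (G x - G y) := by module
  rw [hsub, norm_sub_sq_real, real_inner_smul_right, norm_smul, Real.norm_of_nonneg hγ]
  nlinarith

theorem exists_isContractionConstant {ηF ηG : ℝ} {L : ℝ≥0} [CompleteSpace H]
    (hF : IsMaximalMonotoneWith ηF F) (hG : IsMonotoneWith ηG fun z => {G z})
    (hGL : LipschitzWith L G) (hγ : 0 < γ) (hγF : 0 < 1 + γ * ηF)
    (hA : 0 < 2 * (ηF + ηG) + γ * ηF ^ 2 - γ * (L : ℝ) ^ 2) :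
    ∃ c, IsContractionConstant F G γ c := by
  set q := 1 - 2 * γ * ηG + γ ^ 2 * (L : ℝ) ^ 2
  set μ := 1 + γ * ηF
  have hqμ : q < μ ^ 2 := by nlinarith [mul_pos hγ hA]
  refine ⟨max (1 / 2) (√q / μ), by positivity, max_lt (by norm_num) ?_, fun x y => ?_⟩
  · exact (div_lt_one hγF).2 ((Real.sqrt_lt' hγF).2 hqμ)
  have hforward : ‖(x - γ • G x) - (y - γ • G y)‖ ≤ √q * ‖x - y‖ := by
    have hsqrt := Real.sqrt_le_sqrt (norm_forward_sub_sq_le hG hGL hγ.le x y)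
    rwa [Real.sqrt_sq (norm_nonneg _), Real.sqrt_mul' _ (sq_nonneg _),
      Real.sqrt_sq (norm_nonneg _)] at hsqrt
  have hbackward := hF.1.norm_sub_le_of_mem_resolventVal hγ.le
    (resolventMap_mem (hF.exists_mem_resolventVal hγ hγF (x - γ • G x)))
    (resolventMap_mem (hF.exists_mem_resolventVal hγ hγF (y - γ • G y)))
  calc ‖forwardBackward F G γ x - forwardBackward F G γ y‖ ≤ √q / μ * ‖x - y‖ := by
        rw [div_mul_eq_mul_div, le_div_iff₀ hγF, mul_comm]
        exact hbackward.trans hforward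
    _ ≤ _ := by gcongr; exact le_max_right _ _

theorem neg_mem_iff_mem_resolventVal (hγ : γ ≠ 0) :
    -x' ∈ F x ↔ x ∈ resolventVal F γ (x - γ • x') := by
  rw [mem_resolventVal]
  constructor
  · exact fun h => ⟨_, h, by module⟩
  · rintro ⟨w, hw, h⟩
    rw [sub_eq_add_neg, ← smul_neg] at h
    rwa [← smul_right_injective H hγ (add_left_cancel h)]

theorem IsMaximalMonotoneWith.solvesInclusion_iff_residual_eq_zero [CompleteSpace H]
    (hF : IsMaximalMonotoneWith η F) (hγ : 0 < γ) (hη : 0 < 1 + γ * η) (z : H) :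
    SolvesInclusion F G z ↔ residual F G γ z = 0 := by
  have hJ := resolventMap_mem (hF.exists_mem_resolventVal hγ hη (z - γ • G z))
  have hneg : SolvesInclusion F G z ↔ -G z ∈ F z := by simp [SolvesInclusion]
  rw [hneg, neg_mem_iff_mem_resolventVal hγ.ne', residual, sub_eq_zero, forwardBackward]
  constructor
  · exact fun h => hF.1.eq_of_mem_resolventVal hγ.le hη h hJ
  · intro h
    rwa [← h] at hJ

theorem IsContractionConstant.lipschitzWith (hc : IsContractionConstant F G γ c) :
    LipschitzWith ⟨c, hc.1.le⟩ (forwardBackward F G γ) :=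
  LipschitzWith.of_dist_le_mul fun x y => by
    rw [dist_eq_norm, dist_eq_norm]
    exact hc.2.2 x y

theorem IsContractionConstant.exists_residual_eq_zero [CompleteSpace H]
    (hc : IsContractionConstant F G γ c) : ∃ zs, residual F G γ zs = 0 := by
  have h : ContractingWith ⟨c, hc.1.le⟩ (forwardBackward F G γ) :=
    ⟨NNReal.coe_lt_coe.1 hc.2.1, hc.lipschitzWith⟩
  exact ⟨_, sub_eq_zero.2 h.fixedPoint_isFixedPt.symm⟩

end Resolvent

section StrongMonotonicity

variable {H : Type*} [NormedAddCommGroup H] [InnerProductSpace ℝ H] {m : ℝ} {K : ℝ≥0} {zs : H}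
  {Φ : H → H}

/-- `Φ` is `K`-Lipschitz, vanishes at `zs`, and is strongly monotone with modulus `m` relative to
that point only. For a `c`-contraction `B` with fixed point `zs` this is what remains of
`Φ = id - B`, with `m = 1 - c` and `K = 1 + c`. -/
structure IsLipschitzStronglyMonotoneAt (m : ℝ) (K : ℝ≥0) (zs : H) (Φ : H → H) : Prop where
  modulus_pos : 0 < m
  lipschitzWith : LipschitzWith K Φ
  apply_eq_zero : Φ zs = 0
  le_inner : ∀ x, m * ‖x - zs‖ ^ 2 ≤ inner ℝ (x - zs) (Φ x)

theorem IsContractionConstant.isLipschitzStronglyMonotoneAt {F : H → Set H} {G : H → H} {γ c : ℝ}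
    (hc : IsContractionConstant F G γ c) (hzs : residual F G γ zs = 0) :
    IsLipschitzStronglyMonotoneAt (1 - c) (1 + ⟨c, hc.1.le⟩) zs (residual F G γ) where
  modulus_pos := sub_pos.2 hc.2.1
  lipschitzWith := LipschitzWith.id.sub hc.lipschitzWith
  apply_eq_zero := hzs
  le_inner x := by
    have hB : forwardBackward F G γ zs = zs := (sub_eq_zero.1 hzs).symm
    have hx : residual F G γ x = (x - zs) - (forwardBackward F G γ x - zs) := by
      rw [residual, sub_sub_sub_cancel_right]
    have hcs := real_inner_le_norm (x - zs) (forwardBackward F G γ x - zs)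
    have hlip := mul_le_mul_of_nonneg_left (hc.2.2 x zs) (norm_nonneg (x - zs))
    rw [hB] at hlip
    rw [hx, inner_sub_right, real_inner_self_eq_norm_sq]
    linarith

namespace IsLipschitzStronglyMonotoneAt

theorem mul_norm_sub_le (h : IsLipschitzStronglyMonotoneAt m K zs Φ) (x : H) :
    m * ‖x - zs‖ ≤ ‖Φ x‖ := by
  rcases (norm_nonneg (x - zs)).eq_or_lt with h0 | h0
  · rw [← h0, mul_zero]
    exact norm_nonneg _
  · exact le_of_mul_le_mul_left
      (by linarith [h.le_inner x, real_inner_le_norm (x - zs) (Φ x)]) h0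

theorem norm_le (h : IsLipschitzStronglyMonotoneAt m K zs Φ) (x : H) :
    ‖Φ x‖ ≤ K * ‖x - zs‖ := by
  simpa [h.apply_eq_zero] using h.lipschitzWith.norm_sub_le x zs

theorem eq_zero_iff (h : IsLipschitzStronglyMonotoneAt m K zs Φ) {x : H} :
    Φ x = 0 ↔ x = zs := by
  refine ⟨fun hx => ?_, fun hx => hx ▸ h.apply_eq_zero⟩
  have hle := h.mul_norm_sub_le x
  rw [hx, norm_zero] at hle
  exact sub_eq_zero.1 (norm_le_zero_iff.1 (nonpos_of_mul_nonpos_right hle h.modulus_pos))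

theorem norm_pos (h : IsLipschitzStronglyMonotoneAt m K zs Φ) {x : H} (hx : x ≠ zs) :
    0 < ‖Φ x‖ :=
  norm_pos_iff.2 (mt h.eq_zero_iff.1 hx)

end IsLipschitzStronglyMonotoneAt

end StrongMonotonicity

section Decay

open Set Filter Topology

/-- A nonnegative nonincreasing function on `[0, ∞)` satisfying `V' ≤ -D(V)` as long as it is
positive; nothing is asked of `V` at and after its first zero but monotonicity. -/
structure IsDecaying (D V : ℝ → ℝ) : Prop where
  continuousOn : ContinuousOn V (Ici 0)
  antitoneOn : AntitoneOn V (Ici 0)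
  nonneg : ∀ t, 0 ≤ V t
  deriv_le : ∀ t, 0 < t → 0 < V t → ∃ V', HasDerivAt V V' t ∧ V' ≤ -D (V t)

/-- `W` is nondecreasing with `W' D ≥ 1` on `s`, so that a solution of `V' ≤ -D(V)` needs at most
the time `W v - W w` to decrease from `v` to `w` inside `s`. -/
def IsTimeBound (D W : ℝ → ℝ) (s : Set ℝ) : Prop :=
  ∀ v ∈ s, ∃ w, HasDerivAt W w v ∧ 0 ≤ w ∧ 1 ≤ w * D v

variable {D V W W₁ W₂ : ℝ → ℝ} {s : Set ℝ} {a b t T T₁ T₂ : ℝ}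

theorem IsTimeBound.mono {s' : Set ℝ} (hW : IsTimeBound D W s) (h : s' ⊆ s) :
    IsTimeBound D W s' :=
  fun v hv => hW v (h hv)

theorem IsDecaying.mem_Icc (h : IsDecaying D V) (ha : 0 ≤ a) (ht : t ∈ Icc a b) :
    V t ∈ Icc (V b) (V a) :=
  ⟨h.antitoneOn (ha.trans ht.1) (ha.trans (ht.1.trans ht.2)) ht.2,
    h.antitoneOn ha (ha.trans ht.1) ht.1⟩

theorem IsDecaying.sub_le (h : IsDecaying D V) (ha : 0 ≤ a) (hab : a ≤ b) (hb : 0 < V b)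
    (hW : IsTimeBound D W (Icc (V b) (V a))) : b - a ≤ W (V a) - W (V b) := by
  choose! W' hW' using hW
  choose! V' hV' using h.deriv_le
  have hanti : AntitoneOn (fun t => W (V t) + t) (Icc a b) := by
    refine antitoneOn_of_hasDerivWithinAt_nonpos (convex_Icc a b)
      (f' := fun t => W' (V t) * V' t + 1) (fun t ht => ?_) (fun t ht => ?_) (fun t ht => ?_)
    · have hWt := (hW' _ (h.mem_Icc ha ht)).1.continuousAt
      refine (hWt.comp_continuousWithinAt ?_).add continuousWithinAt_id
      exact (h.continuousOn t (ha.trans ht.1)).mono fun s hs => ha.trans hs.1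
    all_goals
      rw [interior_Icc] at ht
      have hmem := h.mem_Icc ha (Ioo_subset_Icc_self ht)
      have hVt := hV' t (ha.trans_lt ht.1) (hb.trans_le hmem.1)
      have hWt := hW' _ hmem
    · exact ((hWt.1.comp t hVt.1).add (hasDerivAt_id t)).hasDerivWithinAt
    · linarith [mul_le_mul_of_nonneg_left hVt.2 hWt.2.1, hWt.2.2]
  have hle := hanti ⟨le_rfl, hab⟩ ⟨hab, le_rfl⟩ hab
  simp only at hle
  linarith

theorem IsDecaying.eq_zero_of_le (h : IsDecaying D V) (ha : 0 ≤ a) (h0 : V a = 0) (hat : a ≤ t) :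
    V t = 0 :=
  le_antisymm (h0 ▸ h.antitoneOn ha (ha.trans hat) hat) (h.nonneg t)

theorem IsDecaying.add_notMem (h : IsDecaying D V) (hs : s.OrdConnected) (hs0 : s ⊆ Ioi 0)
    (hW : IsTimeBound D W s) (hWT : ∀ v ∈ s, ∀ w ∈ s, W v - W w < T) (ha : 0 ≤ a)
    (hVa : V a ∈ s) : V (a + T) ∉ s := by
  intro hVT
  have hT : 0 < T := by simpa using hWT _ hVa _ hVa
  have hle := h.sub_le ha (le_add_of_nonneg_right hT.le) (hs0 hVT) (hW.mono (hs.out hVT hVa))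
  linarith [hWT _ hVa _ hVT]

theorem IsDecaying.eq_zero_of_isTimeBound (h : IsDecaying D V) (hW : IsTimeBound D W (Ioi 0))
    (hWT : MapsTo W (Ioi 0) (Ioc 0 T)) (ht : T ≤ t) : V t = 0 := by
  have hT : 0 ≤ T := (hWT (mem_Ioi.2 one_pos)).1.le.trans (hWT (mem_Ioi.2 one_pos)).2
  refine h.eq_zero_of_le hT (by_contra fun hne => ?_) ht
  have hVT : 0 < V T := (h.nonneg T).lt_of_ne' hne
  have hV0 : 0 < V 0 := hVT.trans_le (h.mem_Icc le_rfl ⟨hT, le_rfl⟩).2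
  refine h.add_notMem (T := T) (a := 0) ordConnected_Ioi subset_rfl hW (fun v hv w hw => ?_)
    le_rfl hV0 (by rwa [zero_add])
  linarith [(hWT hv).2, (hWT hw).1]

/- `V ≥ 1` lasts at most `T₂` and `0 < V ≤ 1` at most `T₁`. -/
theorem IsDecaying.eq_zero_of_isTimeBound_of_isTimeBound (h : IsDecaying D V)
    (hW₁ : IsTimeBound D W₁ (Ioi 0)) (hWT₁ : MapsTo W₁ (Ioc 0 1) (Ioc 0 T₁))
    (hW₂ : IsTimeBound D W₂ (Ioi 0)) (hWT₂ : MapsTo W₂ (Ici 1) (Ico (-T₂) 0))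
    (ht : T₁ + T₂ ≤ t) : V t = 0 := by
  have hT₁ : 0 < T₁ := (hWT₁ ⟨one_pos, le_rfl⟩).1.trans_le (hWT₁ ⟨one_pos, le_rfl⟩).2
  have hT₂ : 0 < T₂ := by linarith [(hWT₂ (mem_Ici.2 le_rfl)).1, (hWT₂ (mem_Ici.2 le_rfl)).2]
  have hone : V T₂ ≤ 1 := by
    by_contra! hlt
    have hsub : Ici (1 : ℝ) ⊆ Ioi 0 := Ici_subset_Ioi.2 one_pos
    refine h.add_notMem (a := 0) ordConnected_Ici hsub (hW₂.mono hsub) (fun v hv w hw => ?_) le_rfl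
      (hlt.le.trans (h.mem_Icc le_rfl ⟨hT₂.le, le_rfl⟩).2) (by rw [zero_add]; exact hlt.le)
    linarith [(hWT₂ hv).2, (hWT₂ hw).1]
  have hT : T₂ ≤ T₂ + T₁ := le_add_of_nonneg_right hT₁.le
  refine h.eq_zero_of_le (by linarith) (by_contra fun hne => ?_) ((add_comm T₂ T₁).trans_le ht)
  have hpos : 0 < V (T₂ + T₁) := (h.nonneg _).lt_of_ne' hne
  have hle : V (T₂ + T₁) ≤ V T₂ := (h.mem_Icc hT₂.le ⟨hT, le_rfl⟩).2
  refine h.add_notMem ordConnected_Ioc Ioc_subset_Ioi_self (hW₁.mono Ioc_subset_Ioi_self)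
    (fun v hv w hw => ?_) hT₂.le ⟨hpos.trans_le hle, hone⟩ ⟨hpos, hle.trans hone⟩
  linarith [(hWT₁ hv).2, (hWT₁ hw).1]

theorem IsDecaying.tendsto_zero (h : IsDecaying D V) (hD : ∀ v, 0 < v → 0 < D v)
    (hDc : ContinuousOn D (Ioi 0)) : Tendsto V atTop (𝓝 0) := by
  rw [Metric.tendsto_atTop]
  intro ε hε
  obtain ⟨d, hd, hdD⟩ : ∃ d > 0, ∀ v ∈ Icc ε (V 0), d ≤ D v := by
    rcases (Icc ε (V 0)).eq_empty_or_nonempty with he | hne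
    · exact ⟨1, one_pos, by simp [he]⟩
    · obtain ⟨v, hv, hmin⟩ := isCompact_Icc.exists_isMinOn hne
        (hDc.mono fun v hv => hε.trans_le hv.1)
      exact ⟨D v, hD v (hε.trans_le hv.1), fun w hw => hmin hw⟩
  have hT : 0 ≤ V 0 / d := div_nonneg (h.nonneg 0) hd.le
  have hlt : V (V 0 / d) < ε := by
    by_contra! hle
    have hV0 := (h.mem_Icc le_rfl ⟨hT, le_rfl⟩).2
    refine h.add_notMem (s := Icc ε (V 0)) (W := fun v => v / d) (a := 0) ordConnected_Icc
      (fun v hv => hε.trans_le hv.1) (fun v hv => ?_) (fun v hv w hw => ?_) le_rfl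
      ⟨hle.trans hV0, le_rfl⟩ (by rw [zero_add]; exact ⟨hle, hV0⟩)
    · refine ⟨1 / d, (hasDerivAt_id v).div_const d, by positivity, ?_⟩
      rw [one_div, ← div_eq_inv_mul, one_le_div hd]
      exact hdD v hv
    · rw [← sub_div]
      gcongr
      linarith [hv.2, hw.1]
  refine ⟨V 0 / d, fun t ht => ?_⟩
  rw [Real.dist_0_eq_abs, abs_of_nonneg (h.nonneg t)]
  exact (h.mem_Icc hT ⟨ht, le_rfl⟩).2.trans_lt hlt

end Decay

section PowerDecay

open Set

variable {D V : ℝ → ℝ} {M M₁ M₂ N r r₁ r₂ s t : ℝ}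

/- The substitution `x = v ^ (1 - r)` turns `v' = -v ^ r B(v ^ (1 - r))` into
`x' = -(1 - r) B(x)`, which is solved by an antiderivative `A` of `1 / B`. -/
theorem isTimeBound_comp_rpow {A A' : ℝ → ℝ} (hr : r ≠ 1)
    (hA : ∀ x, 0 < x → HasDerivAt A (A' x) x) (hA0 : ∀ x, 0 < x → 0 ≤ A' x)
    (hD : ∀ v, 0 < v → v ^ r ≤ A' (v ^ (1 - r)) * D v) :
    IsTimeBound D (fun v => A (v ^ (1 - r)) / (1 - r)) (Ioi 0) := by
  intro v hv
  have hv0 : 0 < v := hv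
  have hx : 0 < v ^ (1 - r) := Real.rpow_pos_of_pos hv _
  have hvr : 0 < v ^ r := Real.rpow_pos_of_pos hv _
  refine ⟨A' (v ^ (1 - r)) * (v ^ r)⁻¹, ?_, mul_nonneg (hA0 _ hx) (inv_nonneg.2 hvr.le), ?_⟩
  · refine (((hA _ hx).comp v (Real.hasDerivAt_rpow_const (p := 1 - r)
      (Or.inl hv0.ne'))).div_const (1 - r)).congr_deriv ?_
    rw [show 1 - r - 1 = -r by ring, Real.rpow_neg hv0.le]
    field_simp [sub_ne_zero.2 hr.symm]
  · rw [mul_right_comm, ← div_eq_mul_inv, one_le_div hvr]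
    exact hD v hv

theorem isTimeBound_rpow (hM : 0 < M) (hr : r ≠ 1) (hD : ∀ v, 0 < v → M * v ^ r ≤ D v) :
    IsTimeBound D (fun v => v ^ (1 - r) / M / (1 - r)) (Ioi 0) := by
  refine isTimeBound_comp_rpow (A := fun x => x / M) (A' := fun _ => 1 / M) hr
    (fun x _ => (hasDerivAt_id x).div_const M) (fun _ _ => by positivity) fun v hv => ?_
  rw [one_div, ← div_eq_inv_mul, le_div_iff₀' hM]
  exact hD v hv

theorem isTimeBound_log_rpow (hM : 0 < M) (hN : 0 < N) (hr : r ≠ 1)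
    (hD : ∀ v, 0 < v → M * v ^ r + N * v ≤ D v) :
    IsTimeBound D (fun v => Real.log (1 + N / M * v ^ (1 - r)) / N / (1 - r)) (Ioi 0) := by
  refine isTimeBound_comp_rpow (A := fun x => Real.log (1 + N / M * x) / N)
    (A' := fun x => 1 / (M + N * x)) hr (fun x hx => ?_) (fun x hx => by positivity) fun v hv => ?_
  · refine ((((((hasDerivAt_id x).const_mul (N / M)).const_add 1).log
      (by simp only [id]; positivity)).div_const N)).congr_deriv ?_
    simp only [id]
    field_simp
  · have : 0 < v ^ (1 - r) := Real.rpow_pos_of_pos hv _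
    have hv' : v ^ r * v ^ (1 - r) = v := by
      rw [← Real.rpow_add hv, add_sub_cancel, Real.rpow_one]
    rw [one_div, ← div_eq_inv_mul, le_div_iff₀ (by positivity)]
    calc v ^ r * (M + N * v ^ (1 - r)) = M * v ^ r + N * (v ^ r * v ^ (1 - r)) := by ring
      _ ≤ D v := by rw [hv']; exact hD v hv

theorem isTimeBound_arctan_rpow (hM : 0 < M) (hN : 0 < N) (hs : 0 < s)
    (hD : ∀ v, 0 < v → M * v ^ (1 - s) + N * v ^ (1 + s) ≤ D v) :
    IsTimeBound D (fun v => Real.arctan (√(N / M) * v ^ s) / √(M * N) / s) (Ioi 0) := by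
  have h := isTimeBound_comp_rpow (D := D) (r := 1 - s)
    (A := fun x => Real.arctan (√(N / M) * x) / √(M * N))
    (A' := fun x => 1 / (M + N * x ^ 2)) (by simpa using hs.ne') (fun x _ => ?_)
    (fun x _ => by positivity) fun v hv => ?_
  · simpa only [sub_sub_cancel] using h
  · refine ((((hasDerivAt_id x).const_mul √(N / M)).arctan).div_const √(M * N)).congr_deriv ?_
    have hsqrt : √(M * N) = M * √(N / M) := by
      rw [show M * N = M ^ 2 * (N / M) by field_simp, Real.sqrt_mul (by positivity),
        Real.sqrt_sq hM.le]
    have : 0 < √(N / M) := by positivity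
    simp only [id]
    rw [hsqrt, mul_pow, Real.sq_sqrt (by positivity)]
    field_simp
  · have hv' : v ^ (1 - s) * (v ^ s) ^ 2 = v ^ (1 + s) := by
      rw [← Real.rpow_natCast (v ^ s), ← Real.rpow_mul hv.le, ← Real.rpow_add hv]
      ring_nf
    rw [sub_sub_cancel, one_div, ← div_eq_inv_mul, le_div_iff₀ (by positivity)]
    calc v ^ (1 - s) * (M + N * (v ^ s) ^ 2)
        = M * v ^ (1 - s) + N * (v ^ (1 - s) * (v ^ s) ^ 2) := by ring
      _ ≤ D v := by rw [hv']; exact hD v hv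

theorem IsDecaying.eq_zero_of_comp_rpow {A₁ A₂ : ℝ → ℝ} {C₁ C₂ : ℝ} (h : IsDecaying D V)
    (hr₁ : r₁ < 1) (hr₂ : 1 < r₂) (hA₁ : MapsTo A₁ (Ioc 0 1) (Ioc 0 C₁))
    (hA₂ : MapsTo A₂ (Ioc 0 1) (Ioc 0 C₂))
    (hW₁ : IsTimeBound D (fun v => A₁ (v ^ (1 - r₁)) / (1 - r₁)) (Ioi 0))
    (hW₂ : IsTimeBound D (fun v => A₂ (v ^ (1 - r₂)) / (1 - r₂)) (Ioi 0))
    (ht : C₁ / (1 - r₁) + C₂ / (r₂ - 1) ≤ t) : V t = 0 := by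
  have h₁ : 0 < 1 - r₁ := sub_pos.2 hr₁
  have h₂ : 0 < r₂ - 1 := sub_pos.2 hr₂
  refine h.eq_zero_of_isTimeBound_of_isTimeBound hW₁ (fun v hv => ?_) hW₂ (fun v hv => ?_) ht
  · have hA := hA₁ ⟨Real.rpow_pos_of_pos hv.1 _, Real.rpow_le_one hv.1.le hv.2 h₁.le⟩
    exact ⟨div_pos hA.1 h₁, (div_le_div_iff_of_pos_right h₁).2 hA.2⟩
  · have hx : v ^ (1 - r₂) ∈ Ioc 0 1 := ⟨Real.rpow_pos_of_pos (one_pos.trans_le hv) _,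
      Real.rpow_le_one_of_one_le_of_nonpos hv (by linarith)⟩
    have hA := hA₂ hx
    simp only [← neg_sub r₂ 1, div_neg] at hA ⊢
    exact ⟨neg_le_neg ((div_le_div_iff_of_pos_right h₂).2 hA.2), neg_lt_zero.2 (div_pos hA.1 h₂)⟩

theorem IsDecaying.eq_zero_of_rpow (h : IsDecaying D V) (hM₁ : 0 < M₁) (hM₂ : 0 < M₂)
    (hr₁ : r₁ < 1) (hr₂ : 1 < r₂) (hD₁ : ∀ v, 0 < v → M₁ * v ^ r₁ ≤ D v)
    (hD₂ : ∀ v, 0 < v → M₂ * v ^ r₂ ≤ D v)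
    (ht : 1 / (M₁ * (1 - r₁)) + 1 / (M₂ * (r₂ - 1)) ≤ t) : V t = 0 := by
  have hA : ∀ {M : ℝ}, 0 < M → MapsTo (fun x : ℝ => x / M) (Ioc 0 1) (Ioc 0 (1 / M)) :=
    fun hM x hx => ⟨div_pos hx.1 hM, (div_le_div_iff_of_pos_right hM).2 hx.2⟩
  exact h.eq_zero_of_comp_rpow hr₁ hr₂ (hA hM₁) (hA hM₂) (isTimeBound_rpow hM₁ hr₁.ne hD₁)
    (isTimeBound_rpow hM₂ hr₂.ne' hD₂) (by rwa [div_div, div_div])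

theorem IsDecaying.eq_zero_of_rpow_linear (h : IsDecaying D V) (hM₁ : 0 < M₁) (hM₂ : 0 < M₂)
    (hN : 0 < N) (hr₁ : r₁ < 1) (hr₂ : 1 < r₂) (hD₁ : ∀ v, 0 < v → M₁ * v ^ r₁ + N * v ≤ D v)
    (hD₂ : ∀ v, 0 < v → M₂ * v ^ r₂ + N * v ≤ D v)
    (ht : Real.log (1 + N / M₁) / (N * (1 - r₁)) + Real.log (1 + N / M₂) / (N * (r₂ - 1)) ≤ t) :
    V t = 0 := by
  have hA : ∀ {M : ℝ}, 0 < M → MapsTo (fun x : ℝ => Real.log (1 + N / M * x) / N) (Ioc 0 1)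
      (Ioc 0 (Real.log (1 + N / M) / N)) := by
    intro M hM x hx
    have hpos : 0 < N / M * x := mul_pos (div_pos hN hM) hx.1
    refine ⟨div_pos (Real.log_pos (by linarith)) hN, ?_⟩
    dsimp only
    gcongr
    exact mul_le_of_le_one_right (by positivity) hx.2
  exact h.eq_zero_of_comp_rpow hr₁ hr₂ (hA hM₁) (hA hM₂) (isTimeBound_log_rpow hM₁ hN hr₁.ne hD₁)
    (isTimeBound_log_rpow hM₂ hN hr₂.ne' hD₂) (by rwa [div_div, div_div])

theorem IsDecaying.eq_zero_of_rpow_symm (h : IsDecaying D V) (hM₁ : 0 < M₁) (hM₂ : 0 < M₂)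
    (hs : 0 < s) (hD : ∀ v, 0 < v → M₁ * v ^ (1 - s) + M₂ * v ^ (1 + s) ≤ D v)
    (ht : Real.pi / (2 * s * √(M₁ * M₂)) ≤ t) : V t = 0 := by
  refine h.eq_zero_of_isTimeBound (isTimeBound_arctan_rpow hM₁ hM₂ hs hD) (fun v hv => ?_) ht
  have hx : 0 < v ^ s := Real.rpow_pos_of_pos hv _
  have : 0 < Real.arctan (√(M₂ / M₁) * v ^ s) := Real.arctan_pos.2 (by positivity)
  refine ⟨by positivity, ?_⟩
  calc Real.arctan (√(M₂ / M₁) * v ^ s) / √(M₁ * M₂) / s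
      ≤ Real.pi / 2 / √(M₁ * M₂) / s := by gcongr; exact (Real.arctan_lt_pi_div_two _).le
    _ = Real.pi / (2 * s * √(M₁ * M₂)) := by field_simp

end PowerDecay

section DissipativeField

open Set Filter Topology

variable {H : Type*} [NormedAddCommGroup H] [InnerProductSpace ℝ H] {zs : H} {f : H → H}
  {z y : ℝ → H} {a b t T : ℝ}

/-- A field that vanishes at `zs`, is Lipschitz on every annulus around `zs` (but possibly singular
at `zs`), and makes an angle bounded away from `π / 2` with the direction towards `zs`. -/
structure IsDissipativeField (zs : H) (f : H → H) : Prop where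
  apply_eq_zero : f zs = 0
  exists_lipschitzOnWith : ∀ δ R : ℝ, 0 < δ →
    ∃ K : ℝ≥0, LipschitzOnWith K f {x | ‖x - zs‖ ∈ Icc δ R}
  exists_mul_norm_le : ∃ κ > 0, ∀ x, κ * (‖f x‖ * ‖x - zs‖) ≤ -inner ℝ (x - zs) (f x)

/-- A continuous curve on `[0, ∞)` that solves `ż = f(z)` classically as long as it differs
from `zs`; how long it stays at `zs` is not prescribed. -/
structure IsIntegralCurveOff {E : Type*} [NormedAddCommGroup E] [NormedSpace ℝ E] (zs : E)
    (f : E → E) (z : ℝ → E) : Prop where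
  continuousOn : ContinuousOn z (Ici 0)
  hasDerivWithinAt : ∀ t, 0 ≤ t → z t ≠ zs → HasDerivWithinAt z (f (z t)) (Ici 0) t

theorem IsDissipativeField.inner_nonpos (hf : IsDissipativeField zs f) (x : H) :
    inner ℝ (x - zs) (f x) ≤ 0 := by
  obtain ⟨κ, hκ, hle⟩ := hf.exists_mul_norm_le
  exact neg_nonneg.1 (le_trans (by positivity) (hle x))

theorem IsDissipativeField.continuousAt (hf : IsDissipativeField zs f) {x : H} (hx : x ≠ zs) :
    ContinuousAt f x := by
  have hpos : 0 < ‖x - zs‖ := norm_pos_iff.2 (sub_ne_zero.2 hx)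
  obtain ⟨K, hK⟩ := hf.exists_lipschitzOnWith (‖x - zs‖ / 2) (‖x - zs‖ + 1) (half_pos hpos)
  have hnorm : ContinuousAt (fun w : H => ‖w - zs‖) x := by fun_prop
  exact hK.continuousOn.continuousAt
    (hnorm (Icc_mem_nhds (half_lt_self hpos) (lt_add_one _)))

theorem IsSolution.continuousOn {E : Type*} [NormedAddCommGroup E] [NormedSpace ℝ E]
    {f : E → E} {z : ℝ → E} (hz : IsSolution f z) : ContinuousOn z (Ici 0) := by
  intro t ht
  have ht' : 0 ≤ t + 1 := add_nonneg ht zero_le_one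
  have hprim := intervalIntegral.continuousOn_primitive_interval' (hz (t + 1) ht').1 left_mem_uIcc
  rw [uIcc_of_le ht'] at hprim
  have hcont : ContinuousOn z (Icc 0 (t + 1)) :=
    (continuousOn_const.add hprim).congr fun s hs => (hz s hs.1).2
  exact (hcont t ⟨ht, (lt_add_one t).le⟩).mono_of_mem_nhdsWithin
    (inter_mem_nhdsWithin (Ici 0) (Iic_mem_nhds (lt_add_one t)))

theorem IsDissipativeField.isIntegralCurveOff [CompleteSpace H] (hf : IsDissipativeField zs f)
    (hz : IsSolution f z) : IsIntegralCurveOff zs f z := by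
  refine ⟨hz.continuousOn, fun t ht hne => ?_⟩
  have ht' : 0 ≤ t + 1 := add_nonneg ht zero_le_one
  have : Fact (t ∈ Icc 0 (t + 1)) := ⟨⟨ht, (lt_add_one t).le⟩⟩
  have hint := (intervalIntegrable_iff_integrableOn_Icc_of_le ht').1 (hz (t + 1) ht').1
  have hcont : ContinuousWithinAt (fun s => f (z s)) (Icc 0 (t + 1)) t :=
    (hf.continuousAt hne).comp_continuousWithinAt
      ((hz.continuousOn t ht).mono Icc_subset_Ici_self)
  have hprim : HasDerivWithinAt (fun u => ∫ s in (0 : ℝ)..u, f (z s)) (f (z t))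
      (Icc 0 (t + 1)) t :=
    intervalIntegral.integral_hasDerivWithinAt_right (hz t ht).1
      ⟨_, self_mem_nhdsWithin, hint.aestronglyMeasurable⟩ hcont
  have hderiv : HasDerivWithinAt z (f (z t)) (Icc 0 (t + 1)) t :=
    (hprim.const_add (z 0)).congr (fun s hs => (hz s hs.1).2) (hz t ht).2
  exact hderiv.mono_of_mem_nhdsWithin
    (inter_mem_nhdsWithin (Ici 0) (Iic_mem_nhds (lt_add_one t)))

namespace IsIntegralCurveOff

theorem hasDerivAt (hz : IsIntegralCurveOff zs f z) (ht : 0 < t) (hne : z t ≠ zs) :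
    HasDerivAt z (f (z t)) t :=
  (hz.hasDerivWithinAt t ht.le hne).hasDerivAt (Ici_mem_nhds ht)

theorem hasDerivAt_norm_sq (hz : IsIntegralCurveOff zs f z) (ht : 0 < t) (hne : z t ≠ zs) :
    HasDerivAt (fun s => ‖z s - zs‖ ^ 2) (2 * inner ℝ (z t - zs) (f (z t))) t :=
  ((hz.hasDerivAt ht hne).sub_const zs).norm_sq

theorem continuousOn_norm (hz : IsIntegralCurveOff zs f z) :
    ContinuousOn (fun s => ‖z s - zs‖) (Ici 0) :=
  (hz.continuousOn.sub continuousOn_const).norm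

theorem isCompact_setOf_eq (hz : IsIntegralCurveOff zs f z) (ha : 0 ≤ a) :
    IsCompact (Icc a b ∩ z ⁻¹' {zs}) := by
  have hcont : ContinuousOn z (Icc a b) :=
    hz.continuousOn.mono (Icc_subset_Ici_self.trans (Ici_subset_Ici.2 ha))
  exact isCompact_Icc.of_isClosed_subset
    (hcont.preimage_isClosed_of_isClosed isClosed_Icc isClosed_singleton) inter_subset_left

theorem norm_le_of_forall_ne (hz : IsIntegralCurveOff zs f z) (hf : IsDissipativeField zs f)
    (ha : 0 ≤ a) (hab : a ≤ b) (hne : ∀ s ∈ Ioo a b, z s ≠ zs) :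
    ‖z b - zs‖ ≤ ‖z a - zs‖ := by
  have hanti : AntitoneOn (fun s => ‖z s - zs‖ ^ 2) (Icc a b) := by
    refine antitoneOn_of_hasDerivWithinAt_nonpos (convex_Icc _ _)
      (f' := fun t => 2 * inner ℝ (z t - zs) (f (z t)))
      ((hz.continuousOn_norm.pow 2).mono fun s hs => ha.trans hs.1) (fun s hs => ?_) fun s _ => ?_
    · rw [interior_Icc] at hs
      exact (hz.hasDerivAt_norm_sq (ha.trans_lt hs.1) (hne s hs)).hasDerivWithinAt
    · exact mul_nonpos_of_nonneg_of_nonpos zero_le_two (hf.inner_nonpos _)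
  exact le_of_sq_le_sq (hanti ⟨le_rfl, hab⟩ ⟨hab, le_rfl⟩ hab) (norm_nonneg _)

theorem norm_le (hz : IsIntegralCurveOff zs f z) (hf : IsDissipativeField zs f) (ha : 0 ≤ a)
    (hab : a ≤ b) : ‖z b - zs‖ ≤ ‖z a - zs‖ := by
  rcases (Icc a b ∩ z ⁻¹' {zs}).eq_empty_or_nonempty with hempty | hne
  · exact hz.norm_le_of_forall_ne hf ha hab fun s hs hs' =>
      (eq_empty_iff_forall_notMem.1 hempty s) ⟨Ioo_subset_Icc_self hs, hs'⟩
  · obtain ⟨τ, ⟨hτ, hzτ⟩, hmax⟩ := (hz.isCompact_setOf_eq ha).exists_isGreatest hne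
    have hle := hz.norm_le_of_forall_ne hf (ha.trans hτ.1) hτ.2 fun s hs hs' =>
      hs.1.not_ge (hmax ⟨⟨hτ.1.trans hs.1.le, hs.2.le⟩, hs'⟩)
    rw [show z τ = zs from hzτ, sub_self, norm_zero] at hle
    exact hle.trans (norm_nonneg _)

theorem eq_of_le (hz : IsIntegralCurveOff zs f z) (hf : IsDissipativeField zs f) (ha : 0 ≤ a)
    (hab : a ≤ b) (h : z a = zs) : z b = zs := by
  have hle := hz.norm_le hf ha hab
  rw [h, sub_self, norm_zero] at hle
  exact sub_eq_zero.1 (norm_le_zero_iff.1 hle)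

theorem exists_first_eq (hz : IsIntegralCurveOff zs f z) (hb : 0 ≤ b) (h : z b = zs) :
    ∃ T ∈ Icc 0 b, z T = zs ∧ ∀ s ∈ Ico 0 T, z s ≠ zs := by
  obtain ⟨T, ⟨hT, hzT⟩, hmin⟩ :=
    (hz.isCompact_setOf_eq le_rfl).exists_isLeast ⟨b, ⟨hb, le_rfl⟩, h⟩
  exact ⟨T, hT, hzT, fun s hs hs' => hs.2.not_ge (hmin ⟨⟨hs.1, hs.2.le.trans hT.2⟩, hs'⟩)⟩

theorem exists_switching_time (hz : IsIntegralCurveOff zs f z) (hf : IsDissipativeField zs f)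
    (hb : 0 ≤ b) :
    ∃ T ∈ Icc 0 b, (∀ s ∈ Ico 0 T, z s ≠ zs) ∧ ∀ s ∈ Ioc T b, z s = zs := by
  by_cases h : z b = zs
  · obtain ⟨T, hT, hzT, hne⟩ := hz.exists_first_eq hb h
    exact ⟨T, hT, hne, fun s hs => hz.eq_of_le hf hT.1 hs.1.le hzT⟩
  · exact ⟨b, ⟨hb, le_rfl⟩, fun s hs hs' => h (hz.eq_of_le hf hs.1 hs.2.le hs'),
      fun s hs => absurd hs.1 hs.2.not_gt⟩

/- `‖f(z)‖` is dominated by a multiple of `-d/dt ‖z - zs‖`, which is nonnegative and has the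
bounded primitive `-‖z - zs‖`. -/
theorem integrableOn_of_forall_ne [CompleteSpace H] (hz : IsIntegralCurveOff zs f z)
    (hf : IsDissipativeField zs f) (hne : ∀ s ∈ Ico 0 T, z s ≠ zs) :
    IntegrableOn (fun s => f (z s)) (Ioc 0 T) := by
  have hne' : ∀ s ∈ Ioo 0 T, z s ≠ zs := fun s hs => hne s (Ioo_subset_Ico_self hs)
  have hradial : IntegrableOn (fun s => -inner ℝ (z s - zs) (f (z s)) / ‖z s - zs‖) (Ioc 0 T) := by
    refine intervalIntegral.integrableOn_deriv_of_nonneg (g := fun s => -‖z s - zs‖)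
      (hz.continuousOn_norm.neg.mono Icc_subset_Ici_self) (fun s hs => ?_) fun s _ =>
        div_nonneg (neg_nonneg.2 (hf.inner_nonpos _)) (norm_nonneg _)
    have hpos : 0 < ‖z s - zs‖ := norm_pos_iff.2 (sub_ne_zero.2 (hne' s hs))
    have hsqrt := ((hz.hasDerivAt_norm_sq hs.1 (hne' s hs)).sqrt (by positivity)).neg
    simp only [Real.sqrt_sq (norm_nonneg _)] at hsqrt
    rwa [mul_div_mul_left _ _ two_ne_zero, ← neg_div] at hsqrt
  obtain ⟨κ, hκ, hle⟩ := hf.exists_mul_norm_le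
  refine (hradial.const_mul κ⁻¹).mono' ?_ (Eventually.of_forall fun s => ?_)
  · rw [Measure.restrict_congr_set Ioo_ae_eq_Ioc.symm]
    refine ContinuousOn.aestronglyMeasurable (fun s hs => ?_) measurableSet_Ioo
    exact ((hf.continuousAt (hne' s hs)).comp
      (hz.hasDerivAt hs.1 (hne' s hs)).continuousAt).continuousWithinAt
  · by_cases h : z s = zs
    · simp [h, hf.apply_eq_zero]
    · rw [← mul_div_assoc, le_div_iff₀ (norm_pos_iff.2 (sub_ne_zero.2 h)), ← div_eq_inv_mul,
        le_div_iff₀' hκ]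
      exact hle _

theorem isSolution [CompleteSpace H] (hz : IsIntegralCurveOff zs f z)
    (hf : IsDissipativeField zs f) : IsSolution f z := by
  intro t ht
  obtain ⟨T, hT, hne, heq⟩ := hz.exists_switching_time hf ht
  have hbefore : IntervalIntegrable (fun s => f (z s)) volume 0 T :=
    (intervalIntegrable_iff_integrableOn_Ioc_of_le hT.1).2 (hz.integrableOn_of_forall_ne hf hne)
  have hafter : IntervalIntegrable (fun s => f (z s)) volume T t := by
    refine (intervalIntegrable_const (c := (0 : H))).congr fun s hs => ?_
    rw [uIoc_of_le hT.2] at hs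
    simp only [heq s hs, hf.apply_eq_zero]
  refine ⟨hbefore.trans hafter, ?_⟩
  rw [integral_eq_of_hasDerivAt_off_countable_of_le z _ ht (countable_singleton T)
    (hz.continuousOn.mono Icc_subset_Ici_self) (fun s hs => ?_) (hbefore.trans hafter),
    add_sub_cancel]
  rcases lt_or_gt_of_ne hs.2 with h | h
  · exact hz.hasDerivAt hs.1.1 (hne s ⟨hs.1.1.le, h⟩)
  · rw [heq s ⟨h, hs.1.2.le⟩, hf.apply_eq_zero]
    refine (hasDerivAt_const s zs).congr_of_eventuallyEq ?_
    filter_upwards [Ioo_mem_nhds h hs.1.2] with u hu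
    exact heq u (Ioo_subset_Ioc_self hu)

theorem eq_of_ne (hz : IsIntegralCurveOff zs f z) (hy : IsIntegralCurveOff zs f y)
    (hf : IsDissipativeField zs f) (h0 : z 0 = y 0) (hb : 0 ≤ b) (hzb : z b ≠ zs)
    (hyb : y b ≠ zs) : z b = y b := by
  have hδ : 0 < min ‖z b - zs‖ ‖y b - zs‖ :=
    lt_min (norm_pos_iff.2 (sub_ne_zero.2 hzb)) (norm_pos_iff.2 (sub_ne_zero.2 hyb))
  obtain ⟨K, hK⟩ := hf.exists_lipschitzOnWith _ ‖z 0 - zs‖ hδ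
  refine ODE_solution_unique_of_mem_Icc_right (v := fun _ => f) (a := 0) (b := b)
    (s := fun _ => {x | ‖x - zs‖ ∈ Icc (min ‖z b - zs‖ ‖y b - zs‖) ‖z 0 - zs‖}) (fun _ _ => hK)
    (hz.continuousOn.mono Icc_subset_Ici_self) (fun t ht => ?_) (fun t ht => ?_)
    (hy.continuousOn.mono Icc_subset_Ici_self) (fun t ht => ?_) (fun t ht => ?_) h0 ⟨hb, le_rfl⟩
  · exact (hz.hasDerivWithinAt t ht.1 fun h => hzb (hz.eq_of_le hf ht.1 ht.2.le h)).mono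
      (Ici_subset_Ici.2 ht.1)
  · exact ⟨(min_le_left _ _).trans (hz.norm_le hf ht.1 ht.2.le), hz.norm_le hf le_rfl ht.1⟩
  · exact (hy.hasDerivWithinAt t ht.1 fun h => hyb (hy.eq_of_le hf ht.1 ht.2.le h)).mono
      (Ici_subset_Ici.2 ht.1)
  · exact ⟨(min_le_right _ _).trans (hy.norm_le hf ht.1 ht.2.le),
      (hy.norm_le hf le_rfl ht.1).trans_eq (by rw [h0])⟩

theorem eq_target_of_eq_target (hz : IsIntegralCurveOff zs f z) (hy : IsIntegralCurveOff zs f y)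
    (hf : IsDissipativeField zs f) (h0 : z 0 = y 0) (hb : 0 ≤ b) (hzb : z b = zs) :
    y b = zs := by
  by_contra hyb
  obtain ⟨T, hT, hzT, hne⟩ := hz.exists_first_eq hb hzb
  have hyT : y T ≠ zs := fun h => hyb (hy.eq_of_le hf hT.1 hT.2 h)
  rcases hT.1.eq_or_lt with rfl | hT0
  · exact hyT (h0 ▸ hzT)
  · have hIco : EqOn z y (Ico 0 T) := fun s hs => hz.eq_of_ne hy hf h0 hs.1 (hne s hs)
      fun h => hyT (hy.eq_of_le hf hs.1 hs.2.le h)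
    have hIcc : EqOn z y (Icc 0 T) := hIco.of_subset_closure
      (hz.continuousOn.mono Icc_subset_Ici_self) (hy.continuousOn.mono Icc_subset_Ici_self)
      Ico_subset_Icc_self (closure_Ico hT0.ne).ge
    exact hyT ((hIcc ⟨hT.1, le_rfl⟩).symm.trans hzT)

theorem eq_of_apply_zero_eq (hz : IsIntegralCurveOff zs f z) (hy : IsIntegralCurveOff zs f y)
    (hf : IsDissipativeField zs f) (h0 : z 0 = y 0) (ht : 0 ≤ t) : z t = y t := by
  by_cases hzt : z t = zs
  · rw [hzt, hz.eq_target_of_eq_target hy hf h0 ht hzt]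
  · have hyt : y t ≠ zs := mt (hy.eq_target_of_eq_target hz hf h0.symm ht) hzt
    exact hz.eq_of_ne hy hf h0 ht hzt hyt

theorem isDecaying {D : ℝ → ℝ} (hz : IsIntegralCurveOff zs f z) (hf : IsDissipativeField zs f)
    (hD : ∀ x, x ≠ zs → D (‖x - zs‖ ^ 2 / 2) ≤ -inner ℝ (x - zs) (f x)) :
    IsDecaying D (fun t => ‖z t - zs‖ ^ 2 / 2) where
  continuousOn := (hz.continuousOn_norm.pow 2).div_const 2
  antitoneOn a ha b _ hab := by
    have := hz.norm_le hf ha hab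
    dsimp only
    gcongr
  nonneg t := by positivity
  deriv_le t ht hVt := by
    have hne : z t ≠ zs := fun h => by simp [h] at hVt
    exact ⟨_, (hz.hasDerivAt_norm_sq ht hne).div_const 2, by linarith [hD (z t) hne]⟩

end IsIntegralCurveOff

theorem settlingTime_le {E : Type*} [NormedAddCommGroup E] [NormedSpace ℝ E] {z : ℝ → E} {zs : E}
    {T : ℝ} (hT : 0 ≤ T) (h : ∀ t, T ≤ t → z t = zs) : settlingTime z zs ≤ ENNReal.ofReal T :=
  iInf₂_le T.toNNReal (by simpa [Real.coe_toNNReal _ hT] using h)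

namespace IsDissipativeField

theorem isLyapunovStable [CompleteSpace H] (hf : IsDissipativeField zs f) :
    IsLyapunovStable f zs := by
  refine fun ε hε => ⟨ε, hε, fun z hz h0 t ht => ?_⟩
  rw [mem_ball_iff_norm] at h0 ⊢
  exact ((hf.isIntegralCurveOff hz).norm_le hf le_rfl ht).trans_lt h0

theorem isGloballyFixedTimeStable [CompleteSpace H] (hf : IsDissipativeField zs f)
    (hT : ∀ z, IsSolution f z → settlingTime z zs ≤ ENNReal.ofReal T) :
    IsGloballyFixedTimeStable f zs :=
  ⟨⟨hf.apply_eq_zero, hf.isLyapunovStable, fun z hz => (hT z hz).trans_lt ENNReal.ofReal_lt_top⟩,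
    T.toNNReal, hT⟩

theorem isWellPosed [CompleteSpace H] (hf : IsDissipativeField zs f)
    (hex : ∀ x₀ : H, ∃ z, IsIntegralCurveOff zs f z ∧ z 0 = x₀) : IsWellPosed f := by
  refine ⟨fun x₀ => ?_, fun z y hz hy h0 t ht =>
    (hf.isIntegralCurveOff hz).eq_of_apply_zero_eq (hf.isIntegralCurveOff hy) hf h0 ht⟩
  obtain ⟨z, hz, hz0⟩ := hex x₀
  exact ⟨z, hz.isSolution hf, hz0⟩

end IsDissipativeField

end DissipativeField

section GlobalCurves

open Set Filter Topology

variable {E : Type*} [NormedAddCommGroup E] [NormedSpace ℝ E]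

theorem exists_forall_mem_Ioo_hasDerivAt [CompleteSpace E] {g : E → E} {K C : ℝ≥0}
    (hg : LipschitzWith K g) (hC : ∀ x, ‖g x‖ ≤ C) (x₀ : E) (r : ℝ≥0) :
    ∃ α : ℝ → E, α 0 = x₀ ∧ ∀ t ∈ Ioo (-(r : ℝ)) r, HasDerivAt α (g (α t)) t := by
  have hpl : IsPicardLindelof (fun _ : ℝ => g) (⟨0, by simp⟩ : Icc (-(r : ℝ)) r) x₀ (C * r) 0 C K :=
    ⟨fun _ _ => hg.lipschitzOnWith, fun _ _ => continuousOn_const, fun _ _ x _ => hC x, by simp⟩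
  obtain ⟨α, hα0, hα⟩ := hpl.exists_eq_forall_mem_Icc_hasDerivWithinAt₀
  exact ⟨α, hα0, fun t ht =>
    (hα t (Ioo_subset_Icc_self ht)).hasDerivAt (Icc_mem_nhds ht.1 ht.2)⟩

theorem exists_forall_hasDerivAt_of_lipschitzWith_of_bounded [CompleteSpace E] {g : E → E}
    {K C : ℝ≥0} (hg : LipschitzWith K g) (hC : ∀ x, ‖g x‖ ≤ C) (x₀ : E) :
    ∃ y : ℝ → E, y 0 = x₀ ∧ ∀ t, HasDerivAt y (g (y t)) t := by
  choose α hα0 hα using exists_forall_mem_Ioo_hasDerivAt hg hC x₀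
  have hagree : ∀ r r' : ℝ≥0, r ≤ r' → EqOn (α r) (α r') (Ioo (-(r : ℝ)) r) := by
    intro r r' hr t ht
    have hr' : (r : ℝ) ≤ r' := NNReal.coe_le_coe.2 hr
    exact ODE_solution_unique_of_mem_Ioo (v := fun _ => g) (s := fun _ => univ) (t₀ := 0)
      (fun _ _ => hg.lipschitzOnWith) (by constructor <;> linarith [ht.1, ht.2])
      (fun s hs => ⟨hα r s hs, mem_univ _⟩)
      (fun s hs => ⟨hα r' s (Ioo_subset_Ioo (neg_le_neg hr') hr' hs), mem_univ _⟩)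
      ((hα0 r).trans (hα0 r').symm) ht
  have hmem : ∀ t : ℝ, t ∈ Ioo (-((‖t‖₊ + 1 : ℝ≥0) : ℝ)) (‖t‖₊ + 1 : ℝ≥0) := fun t =>
    abs_lt.1 (by simp [← Real.norm_eq_abs])
  refine ⟨fun t => α (‖t‖₊ + 1) t, hα0 _, fun t => ?_⟩
  refine (hα _ t (hmem t)).congr_of_eventuallyEq ?_
  filter_upwards [Ioo_mem_nhds (hmem t).1 (hmem t).2] with s hs
  rcases le_total (‖s‖₊ + 1) (‖t‖₊ + 1) with h | h
  · exact hagree _ _ h (hmem s)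
  · exact (hagree _ _ h hs).symm

theorem lipschitzWith_inv_one_add_norm_smul : LipschitzWith 2 fun v : E => (1 + ‖v‖)⁻¹ • v := by
  refine LipschitzWith.of_dist_le_mul fun v w => ?_
  rw [dist_eq_norm, dist_eq_norm]
  have hsplit : (1 + ‖v‖)⁻¹ • v - (1 + ‖w‖)⁻¹ • w =
      (1 + ‖v‖)⁻¹ • (v - w) + ((1 + ‖v‖)⁻¹ * (‖w‖ - ‖v‖) * (1 + ‖w‖)⁻¹) • w := by
    have hinv : (1 + ‖v‖)⁻¹ * (‖w‖ - ‖v‖) * (1 + ‖w‖)⁻¹ = (1 + ‖v‖)⁻¹ - (1 + ‖w‖)⁻¹ := by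
      field_simp
      ring
    rw [hinv]
    module
  have hv : (1 + ‖v‖)⁻¹ ≤ 1 := inv_le_one_of_one_le₀ (by linarith [norm_nonneg v])
  have hw : (1 + ‖w‖)⁻¹ * ‖w‖ ≤ 1 := by
    rw [inv_mul_le_iff₀ (by positivity)]
    linarith
  calc ‖(1 + ‖v‖)⁻¹ • v - (1 + ‖w‖)⁻¹ • w‖
      ≤ (1 + ‖v‖)⁻¹ * ‖v - w‖ + (1 + ‖v‖)⁻¹ * |‖w‖ - ‖v‖| * ((1 + ‖w‖)⁻¹ * ‖w‖) := by
        rw [hsplit]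
        refine (norm_add_le _ _).trans_eq ?_
        simp only [norm_smul, norm_mul, norm_inv, Real.norm_eq_abs, mul_assoc,
          abs_of_nonneg (add_nonneg zero_le_one (norm_nonneg _))]
    _ ≤ 1 * ‖v - w‖ + 1 * ‖v - w‖ * 1 := by
        gcongr
        rw [norm_sub_rev]
        exact abs_norm_sub_norm_le w v
    _ = (2 : ℝ≥0) * ‖v - w‖ := by
        push_cast
        ring

end GlobalCurves

section ScaledField

open Set Filter Topology

variable {H : Type*} [NormedAddCommGroup H] [InnerProductSpace ℝ H] {m : ℝ} {K : ℝ≥0} {zs : H}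
  {Φ : H → H} {ψ : ℝ → ℝ} {a b : ℝ}

/-- The descent field `-ψ(‖Φ(x)‖) Φ(x)`; the flow under study and its damped version both have this
form, with different gains `ψ`. -/
def scaledField (ψ : ℝ → ℝ) (Φ : H → H) (x : H) : H :=
  -(ψ ‖Φ x‖) • Φ x

theorem scaledField_eq_neg_comp : scaledField ψ Φ = -((fun v => ψ ‖v‖ • v) ∘ Φ) :=
  funext fun _ => neg_smul _ _

theorem neg_inner_scaledField (x : H) :
    -inner ℝ (x - zs) (scaledField ψ Φ x) = ψ ‖Φ x‖ * inner ℝ (x - zs) (Φ x) := by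
  rw [scaledField, real_inner_smul_right, neg_mul, neg_neg]

theorem exists_lipschitzOnWith_norm_smul {L : ℝ≥0} (hψ : LipschitzOnWith L ψ (Icc a b)) :
    ∃ C : ℝ≥0, LipschitzOnWith C (fun v : H => ψ ‖v‖ • v) {v | ‖v‖ ∈ Icc a b} := by
  obtain ⟨M, hM⟩ := isCompact_Icc.exists_bound_of_continuousOn hψ.continuousOn
  refine ⟨(M + L * b).toNNReal, LipschitzOnWith.of_dist_le_mul fun v hv w hw => ?_⟩
  have hψvw : |ψ ‖v‖ - ψ ‖w‖| ≤ L * ‖v - w‖ := by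
    refine (hψ.dist_le_mul _ hv _ hw).trans ?_
    gcongr
    exact abs_norm_sub_norm_le v w
  have hsplit : ψ ‖v‖ • v - ψ ‖w‖ • w = ψ ‖v‖ • (v - w) + (ψ ‖v‖ - ψ ‖w‖) • w := by module
  rw [dist_eq_norm, dist_eq_norm, hsplit]
  calc ‖ψ ‖v‖ • (v - w) + (ψ ‖v‖ - ψ ‖w‖) • w‖
      ≤ ‖ψ ‖v‖‖ * ‖v - w‖ + |ψ ‖v‖ - ψ ‖w‖| * ‖w‖ := by
        rw [← norm_smul, ← Real.norm_eq_abs, ← norm_smul]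
        exact norm_add_le _ _
    _ ≤ M * ‖v - w‖ + L * ‖v - w‖ * b := by
        gcongr
        · exact hM _ hv
        · exact hw.2
    _ = (M + L * b) * ‖v - w‖ := by ring
    _ ≤ (M + L * b).toNNReal * ‖v - w‖ := by
        gcongr
        exact Real.le_coe_toNNReal _

namespace IsLipschitzStronglyMonotoneAt

theorem mul_norm_mul_le_inner (h : IsLipschitzStronglyMonotoneAt m K zs Φ) (x : H) :
    m / (K + 1) * (‖Φ x‖ * ‖x - zs‖) ≤ inner ℝ (x - zs) (Φ x) := by
  have hm := h.modulus_pos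
  have : (0 : ℝ) < K + 1 := by positivity
  calc m / (K + 1) * (‖Φ x‖ * ‖x - zs‖) ≤ m / (K + 1) * ((K + 1) * ‖x - zs‖ * ‖x - zs‖) := by
        gcongr
        nlinarith [h.norm_le x, norm_nonneg (x - zs)]
    _ = m * ‖x - zs‖ ^ 2 := by
        field_simp
    _ ≤ inner ℝ (x - zs) (Φ x) := h.le_inner x

theorem exists_lipschitzOnWith_scaledField (h : IsLipschitzStronglyMonotoneAt m K zs Φ)
    (hψ : LocallyLipschitzOn (Ioi 0) ψ) (ha : 0 < a) :
    ∃ C : ℝ≥0, LipschitzOnWith C (scaledField ψ Φ) {x | ‖x - zs‖ ∈ Icc a b} := by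
  have hma : 0 < m * a := mul_pos h.modulus_pos ha
  obtain ⟨L, hL⟩ := (hψ.mono fun ρ (hρ : ρ ∈ Icc (m * a) (K * b)) =>
    hma.trans_le hρ.1).exists_lipschitzOnWith_of_compact isCompact_Icc
  obtain ⟨C, hC⟩ := exists_lipschitzOnWith_norm_smul (H := H) hL
  have hmaps : MapsTo Φ {x | ‖x - zs‖ ∈ Icc a b} {v | ‖v‖ ∈ Icc (m * a) (K * b)} := fun x hx =>
    ⟨(mul_le_mul_of_nonneg_left hx.1 h.modulus_pos.le).trans (h.mul_norm_sub_le x),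
      (h.norm_le x).trans (mul_le_mul_of_nonneg_left hx.2 K.2)⟩
  refine ⟨C * K, ?_⟩
  rw [scaledField_eq_neg_comp]
  exact (hC.comp h.lipschitzWith.lipschitzOnWith hmaps).neg

theorem isDissipativeField_scaledField (h : IsLipschitzStronglyMonotoneAt m K zs Φ)
    (hψ : ∀ ρ, 0 < ρ → 0 < ψ ρ) (hψL : LocallyLipschitzOn (Ioi 0) ψ) :
    IsDissipativeField zs (scaledField ψ Φ) where
  apply_eq_zero := by simp [scaledField, h.apply_eq_zero]
  exists_lipschitzOnWith _ _ hδ := h.exists_lipschitzOnWith_scaledField hψL hδ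
  exists_mul_norm_le := by
    refine ⟨m / (K + 1), div_pos h.modulus_pos (by positivity), fun x => ?_⟩
    rw [neg_inner_scaledField]
    rcases eq_or_ne x zs with rfl | hx
    · simp
    · have hpos := hψ _ (h.norm_pos hx)
      rw [scaledField, norm_smul, norm_neg, Real.norm_of_nonneg hpos.le, mul_assoc, mul_left_comm]
      exact mul_le_mul_of_nonneg_left (h.mul_norm_mul_le_inner x) hpos.le

end IsLipschitzStronglyMonotoneAt

end ScaledField

section DampedFlow

open Set Filter Topology

variable {H : Type*} [NormedAddCommGroup H] [InnerProductSpace ℝ H] {m : ℝ} {K : ℝ≥0} {zs : H}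
  {Φ : H → H} {y : ℝ → H}

/-- The gain `ρ ↦ 1 / (1 + ρ)`, for which the scaled field is bounded and globally Lipschitz. -/
noncomputable def dampedGain (ρ : ℝ) : ℝ :=
  (1 + ρ)⁻¹

theorem dampedGain_pos {ρ : ℝ} (hρ : 0 ≤ ρ) : 0 < dampedGain ρ := by
  unfold dampedGain
  positivity

theorem norm_scaledField_dampedGain_le (x : H) : ‖scaledField dampedGain Φ x‖ ≤ 1 := by
  rw [scaledField, norm_smul, norm_neg, Real.norm_of_nonneg (dampedGain_pos (norm_nonneg _)).le,
    dampedGain, inv_mul_le_iff₀ (by positivity)]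
  linarith

theorem lipschitzWith_scaledField_dampedGain (hΦ : LipschitzWith K Φ) :
    LipschitzWith (2 * K) (scaledField dampedGain Φ) := by
  rw [scaledField_eq_neg_comp]
  exact (lipschitzWith_inv_one_add_norm_smul.comp hΦ).neg

theorem locallyLipschitzOn_dampedGain : LocallyLipschitzOn (Ioi 0) dampedGain :=
  ((contDiffOn_const.add contDiffOn_id).inv fun ρ (hρ : 0 < ρ) =>
    (add_pos one_pos hρ).ne').locallyLipschitzOn (convex_Ioi 0)

namespace IsLipschitzStronglyMonotoneAt

theorem damped_curve_ne (h : IsLipschitzStronglyMonotoneAt m K zs Φ)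
    (hy : ∀ t, HasDerivAt y (scaledField dampedGain Φ (y t)) t) (h0 : y 0 ≠ zs) (t : ℝ) :
    y t ≠ zs := by
  intro ht
  have hconst : y = fun _ => zs := by
    refine ODE_solution_unique_univ (v := fun _ => scaledField dampedGain Φ) (s := fun _ => univ)
      (fun _ => (lipschitzWith_scaledField_dampedGain h.lipschitzWith).lipschitzOnWith)
      (fun s => ⟨hy s, mem_univ _⟩) (fun s => ⟨?_, mem_univ _⟩) ht
    simpa [scaledField, h.apply_eq_zero] using hasDerivAt_const s zs
  exact h0 (congrFun hconst 0)

theorem le_neg_inner_scaledField_dampedGain (h : IsLipschitzStronglyMonotoneAt m K zs Φ) (x : H) :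
    dampedGain (K * √(2 * (‖x - zs‖ ^ 2 / 2))) * (m * (2 * (‖x - zs‖ ^ 2 / 2))) ≤
      -inner ℝ (x - zs) (scaledField dampedGain Φ x) := by
  have hm := h.modulus_pos
  rw [neg_inner_scaledField, mul_div_cancel₀ _ two_ne_zero, Real.sqrt_sq (norm_nonneg _)]
  unfold dampedGain
  gcongr
  · exact h.norm_le x
  · exact h.le_inner x

theorem tendsto_damped_curve (h : IsLipschitzStronglyMonotoneAt m K zs Φ)
    (hy : ∀ t, HasDerivAt y (scaledField dampedGain Φ (y t)) t) : Tendsto y atTop (𝓝 zs) := by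
  have hm := h.modulus_pos
  have hcurve : IsIntegralCurveOff zs (scaledField dampedGain Φ) y :=
    ⟨fun t _ => (hy t).continuousAt.continuousWithinAt, fun t _ _ => (hy t).hasDerivWithinAt⟩
  have hdecay : IsDecaying (fun v => dampedGain (K * √(2 * v)) * (m * (2 * v)))
      (fun t => ‖y t - zs‖ ^ 2 / 2) :=
    hcurve.isDecaying (h.isDissipativeField_scaledField (fun ρ hρ => dampedGain_pos hρ.le)
      locallyLipschitzOn_dampedGain) fun x _ => h.le_neg_inner_scaledField_dampedGain x
  have hV := hdecay.tendsto_zero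
    (fun v hv => mul_pos (dampedGain_pos (by positivity)) (by positivity)) (by
      unfold dampedGain
      exact ContinuousOn.mul (ContinuousOn.inv₀ (by fun_prop) fun v _ => by positivity)
        (by fun_prop))
  rw [tendsto_iff_norm_sub_tendsto_zero]
  simpa [mul_div_cancel₀, Real.sqrt_sq] using (hV.const_mul 2).sqrt

end IsLipschitzStronglyMonotoneAt

end DampedFlow

section TimeChange

open Set Filter Topology

theorem continuousAt_extend_of_tendsto {X : Type*} [TopologicalSpace X] {x : X} {y : ℝ → X}
    {θ : ℝ → ℝ} {τ t : ℝ} (hθ : StrictMono θ) (hθc : Continuous θ)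
    (hy : Tendsto y atTop (𝓝 x)) (hτ : θ τ ≤ t) (ht : t ∉ range θ) :
    ContinuousAt (Function.extend θ y fun _ => x) t := by
  rw [ContinuousAt, Function.extend_apply' _ _ _ ht]
  refine fun U hU => mem_map.2 ?_
  obtain ⟨τ₀, hτ₀⟩ := eventually_atTop.1 (hy.eventually_mem hU)
  have hlt : θ τ₀ < t := not_le.1 fun hle =>
    ht (mem_range_of_exists_le_of_exists_ge hθc ⟨τ, hτ⟩ ⟨τ₀, hle⟩)
  filter_upwards [Ioi_mem_nhds hlt] with s hs
  by_cases hs' : s ∈ range θ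
  · obtain ⟨σ, rfl⟩ := hs'
    rw [mem_preimage, hθ.injective.extend_apply]
    exact hτ₀ σ (hθ.lt_iff_lt.1 hs).le
  · rw [mem_preimage, Function.extend_apply' _ _ _ hs']
    exact mem_of_mem_nhds hU

variable {E : Type*} [NormedAddCommGroup E] [NormedSpace ℝ E] {zs : E} {f : E → E} {q : ℝ → ℝ}
  {θ : ℝ → ℝ} {y e : ℝ → E}

theorem hasDerivAt_extend {c τ : ℝ} {y' : E} (hθ : Function.Injective θ)
    (hθ' : HasStrictDerivAt θ c τ) (hc : c ≠ 0) (hy : HasDerivAt y y' τ) :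
    HasDerivAt (Function.extend θ y e) (c⁻¹ • y') (θ τ) := by
  have hinv : ∀ t, Function.invFun θ (θ t) = t := Function.leftInverse_invFun hθ
  have hσ : HasDerivAt (Function.invFun θ) c⁻¹ (θ τ) :=
    (hθ'.to_local_left_inverse hc (Eventually.of_forall hinv)).hasDerivAt
  have hcomp : HasDerivAt (y ∘ Function.invFun θ) (c⁻¹ • y') (θ τ) :=
    HasDerivAt.scomp (θ τ) (by rwa [hinv]) hσ
  refine hcomp.congr_of_eventuallyEq ?_
  have hrange : range θ ∈ 𝓝 (θ τ) := by
    rw [← hθ'.map_nhds_eq hc]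
    exact range_mem_map
  filter_upwards [hrange]
  rintro _ ⟨t, rfl⟩
  rw [hθ.extend_apply, Function.comp_apply, hinv]

/- The new time `θ(τ) = ∫₀^τ q` may stay bounded, in which case the reparametrised curve reaches
`zs` in finite time and is continued there by the constant `zs`. -/
theorem exists_isIntegralCurveOff_of_timeChange (hq : Continuous q) (hq0 : ∀ τ, 0 < q τ)
    (hy : ∀ τ, HasDerivAt y (q τ • f (y τ)) τ) (hlim : Tendsto y atTop (𝓝 zs)) :
    ∃ z, IsIntegralCurveOff zs f z ∧ z 0 = y 0 := by
  set θ : ℝ → ℝ := fun τ => ∫ s in (0 : ℝ)..τ, q s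
  have hθ' : ∀ τ, HasStrictDerivAt θ (q τ) τ := fun τ =>
    intervalIntegral.integral_hasStrictDerivAt_right (hq.intervalIntegrable _ _)
      (hq.stronglyMeasurableAtFilter _ _) hq.continuousAt
  have hmono : StrictMono θ := strictMono_of_hasDerivAt_pos (fun τ => (hθ' τ).hasDerivAt) hq0
  have hcont : Continuous θ :=
    continuous_iff_continuousAt.2 fun τ => (hθ' τ).hasDerivAt.continuousAt
  have hθ0 : θ 0 = 0 := intervalIntegral.integral_same
  set z : ℝ → E := Function.extend θ y fun _ => zs
  have hzθ : ∀ τ, z (θ τ) = y τ := hmono.injective.extend_apply _ _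
  have hderiv : ∀ τ, HasDerivAt z (f (z (θ τ))) (θ τ) := fun τ => by
    have h := hasDerivAt_extend (e := fun _ => zs) hmono.injective (hθ' τ) (hq0 τ).ne' (hy τ)
    rwa [inv_smul_smul₀ (hq0 τ).ne', ← hzθ τ] at h
  refine ⟨z, ⟨fun t ht => ContinuousAt.continuousWithinAt ?_, fun t _ hne => ?_⟩,
    by rw [← hzθ 0, hθ0]⟩
  · by_cases htr : t ∈ range θ
    · obtain ⟨τ, rfl⟩ := htr
      exact (hderiv τ).continuousAt
    · exact continuousAt_extend_of_tendsto hmono hcont hlim (hθ0.trans_le ht) htr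
  · have htr : t ∈ range θ := by
      by_contra htr
      exact hne (Function.extend_apply' _ _ _ htr)
    obtain ⟨τ, rfl⟩ := htr
    exact (hderiv τ).hasDerivWithinAt

end TimeChange

section Existence

open Set Filter Topology

variable {H : Type*} [NormedAddCommGroup H] [InnerProductSpace ℝ H] [CompleteSpace H] {m : ℝ}
  {K : ℝ≥0} {zs : H} {Φ : H → H} {ψ : ℝ → ℝ}

namespace IsLipschitzStronglyMonotoneAt

theorem exists_isIntegralCurveOff_scaledField (h : IsLipschitzStronglyMonotoneAt m K zs Φ)
    (hψ : ∀ ρ, 0 < ρ → 0 < ψ ρ) (hψc : ContinuousOn ψ (Ioi 0)) (x₀ : H) :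
    ∃ z, IsIntegralCurveOff zs (scaledField ψ Φ) z ∧ z 0 = x₀ := by
  rcases eq_or_ne x₀ zs with rfl | hx₀
  · exact ⟨fun _ => x₀, ⟨continuousOn_const, fun t _ hne => absurd rfl hne⟩, rfl⟩
  obtain ⟨y, rfl, hy⟩ := exists_forall_hasDerivAt_of_lipschitzWith_of_bounded (C := 1)
    (lipschitzWith_scaledField_dampedGain h.lipschitzWith) norm_scaledField_dampedGain_le x₀
  have hpos : ∀ τ, 0 < ‖Φ (y τ)‖ := fun τ => h.norm_pos (h.damped_curve_ne hy hx₀ τ)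
  have hψpos : ∀ τ, 0 < ψ ‖Φ (y τ)‖ := fun τ => hψ _ (hpos τ)
  have hyc : Continuous y := continuous_iff_continuousAt.2 fun τ => (hy τ).continuousAt
  have hρc : Continuous fun τ => ‖Φ (y τ)‖ := (h.lipschitzWith.continuous.comp hyc).norm
  refine exists_isIntegralCurveOff_of_timeChange
    (q := fun τ => dampedGain ‖Φ (y τ)‖ / ψ ‖Φ (y τ)‖) ?_
    (fun τ => div_pos (dampedGain_pos (hpos τ).le) (hψpos τ)) (fun τ => ?_)
    (h.tendsto_damped_curve hy)
  · exact (locallyLipschitzOn_dampedGain.continuousOn.comp_continuous hρc hpos).div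
      (hψc.comp_continuous hρc hpos) fun τ => (hψpos τ).ne'
  · convert hy τ using 1
    rw [scaledField, scaledField, smul_smul, mul_neg, div_mul_cancel₀ _ (hψpos τ).ne']

theorem isWellPosed_scaledField (h : IsLipschitzStronglyMonotoneAt m K zs Φ)
    (hψ : ∀ ρ, 0 < ρ → 0 < ψ ρ) (hψL : LocallyLipschitzOn (Ioi 0) ψ) :
    IsWellPosed (scaledField ψ Φ) :=
  (h.isDissipativeField_scaledField hψ hψL).isWellPosed
    (h.exists_isIntegralCurveOff_scaledField hψ hψL.continuousOn)

end IsLipschitzStronglyMonotoneAt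

end Existence

section Gain

open Set

variable {k b b₁ b₂ b₃ p p₁ p₂ p₃ m K v ρ : ℝ}

/-- The gain `k ω` of the flow under study as a function of `ρ = ‖Φ(z)‖ > 0`, where `k = K_p / T_p`.
At `ρ = 0` its value is irrelevant, since it multiplies `Φ(z) = 0`. -/
noncomputable def gain (k b₁ b₂ b₃ p₁ p₂ p₃ ρ : ℝ) : ℝ :=
  k * (b₁ * (1 / ρ ^ (1 - p₁)) + b₂ * (1 / ρ ^ (1 - p₂)) + b₃ * (1 / ρ ^ p₃))

/-- The constant `M₁` of the settling-time bounds, which governs the decay of `‖z - z*‖² / 2` near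
`z*`; here `m` and `K` stand for `1 - c` and `1 + c`. -/
noncomputable def nearRate (k b m K p : ℝ) : ℝ :=
  (2 : ℝ) ^ ((1 + p) / 2) * k * (b * m / K ^ (1 - p))

/-- The constant `M₂` of the settling-time bounds, which governs the decay of `‖z - z*‖² / 2` far
from `z*`; here `m` stands for `1 - c`. -/
noncomputable def farRate (k b m p : ℝ) : ℝ :=
  (2 : ℝ) ^ ((1 + p) / 2) * k * (m ^ p * b)

theorem gain_pos (hk : 0 < k) (hb₁ : 0 < b₁) (hb₂ : 0 < b₂) (hb₃ : 0 ≤ b₃) (hρ : 0 < ρ) :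
    0 < gain k b₁ b₂ b₃ p₁ p₂ p₃ ρ := by
  unfold gain
  positivity

theorem nearRate_pos (hk : 0 < k) (hb : 0 < b) (hm : 0 < m) (hK : 0 < K) :
    0 < nearRate k b m K p := by
  unfold nearRate
  positivity

theorem farRate_pos (hk : 0 < k) (hb : 0 < b) (hm : 0 < m) : 0 < farRate k b m p := by
  unfold farRate
  positivity

theorem locallyLipschitzOn_gain : LocallyLipschitzOn (Ioi 0) (gain k b₁ b₂ b₃ p₁ p₂ p₃) := by
  have hpow : ∀ p : ℝ, ContDiffOn ℝ 1 (fun ρ : ℝ => 1 / ρ ^ p) (Ioi 0) := fun p =>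
    contDiffOn_const.div (contDiffOn_id.rpow_const_of_ne fun ρ (hρ : 0 < ρ) => hρ.ne')
      fun ρ hρ => (Real.rpow_pos_of_pos hρ _).ne'
  have hgain : ContDiffOn ℝ 1 (gain k b₁ b₂ b₃ p₁ p₂ p₃) (Ioi 0) :=
    contDiffOn_const.mul (((contDiffOn_const.mul (hpow _)).add (contDiffOn_const.mul (hpow _))).add
      (contDiffOn_const.mul (hpow _)))
  exact hgain.locallyLipschitzOn (convex_Ioi 0)

theorem two_rpow_mul_sq_div_two_rpow (hv : 0 ≤ v) (p : ℝ) :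
    (2 : ℝ) ^ ((1 + p) / 2) * (v ^ 2 / 2) ^ ((1 + p) / 2) = v ^ (1 + p) := by
  rw [← Real.mul_rpow zero_le_two (by positivity), mul_div_cancel₀ _ two_ne_zero,
    ← Real.rpow_two, ← Real.rpow_mul hv, mul_div_cancel₀ _ two_ne_zero]

theorem nearRate_mul_rpow_le (hk : 0 ≤ k) (hb : 0 ≤ b) (hm : 0 ≤ m) (hK : 0 ≤ K) (hp : p ≤ 1)
    (hv : 0 < v) (hρ : 0 < ρ) (hle : ρ ≤ K * v) :
    nearRate k b m K p * (v ^ 2 / 2) ^ ((1 + p) / 2) ≤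
      k * (b * (1 / ρ ^ (1 - p))) * (m * v ^ 2) := by
  have hsq : v ^ 2 = v ^ (1 + p) * v ^ (1 - p) := by
    rw [← Real.rpow_add hv, add_add_sub_cancel, one_add_one_eq_two, Real.rpow_two]
  have : 0 < v ^ (1 - p) := Real.rpow_pos_of_pos hv _
  calc nearRate k b m K p * (v ^ 2 / 2) ^ ((1 + p) / 2)
      = k * (b * m / K ^ (1 - p)) *
          ((2 : ℝ) ^ ((1 + p) / 2) * (v ^ 2 / 2) ^ ((1 + p) / 2)) := by
        rw [nearRate]
        ring
    _ = k * (b * (1 / (K * v) ^ (1 - p))) * (m * v ^ 2) := by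
        rw [two_rpow_mul_sq_div_two_rpow hv.le, hsq, Real.mul_rpow hK hv.le]
        field_simp
    _ ≤ k * (b * (1 / ρ ^ (1 - p))) * (m * v ^ 2) := by
        have := sub_nonneg.2 hp
        gcongr

theorem farRate_mul_rpow_le (hk : 0 ≤ k) (hb : 0 ≤ b) (hm : 0 < m) (hp : 1 ≤ p) (hv : 0 < v)
    (hle : m * v ≤ ρ) :
    farRate k b m p * (v ^ 2 / 2) ^ ((1 + p) / 2) ≤
      k * (b * (1 / ρ ^ (1 - p))) * (m * v ^ 2) := by
  have hρ : 0 ≤ ρ := (by positivity : 0 ≤ m * v).trans hle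
  have hvp : v ^ (1 + p) = v ^ (p - 1) * v ^ 2 := by
    rw [← Real.rpow_two, ← Real.rpow_add hv]
    ring_nf
  have hmp : m ^ p = m ^ (p - 1) * m := by
    rw [← Real.rpow_add_one hm.ne', sub_add_cancel]
  calc farRate k b m p * (v ^ 2 / 2) ^ ((1 + p) / 2)
      = k * (m ^ p * b) * ((2 : ℝ) ^ ((1 + p) / 2) * (v ^ 2 / 2) ^ ((1 + p) / 2)) := by
        rw [farRate]
        ring
    _ = k * (b * (m * v) ^ (p - 1)) * (m * v ^ 2) := by
        rw [two_rpow_mul_sq_div_two_rpow hv.le, hvp, hmp, Real.mul_rpow hm.le hv.le]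
        ring
    _ ≤ k * (b * ρ ^ (p - 1)) * (m * v ^ 2) := by
        have := sub_nonneg.2 hp
        gcongr
    _ = k * (b * (1 / ρ ^ (1 - p))) * (m * v ^ 2) := by
        rw [one_div, ← Real.rpow_neg hρ, neg_sub]

end Gain

section SettlingTime

variable {H : Type*} [NormedAddCommGroup H] [InnerProductSpace ℝ H] {m : ℝ} {K : ℝ≥0} {zs x : H}
  {Φ : H → H} {k b₁ b₂ b₃ p₁ p₂ p₃ N s t : ℝ} {z : ℝ → H}

namespace IsLipschitzStronglyMonotoneAt

theorem rpow_add_rpow_add_le_neg_inner_scaledField_gain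
    (h : IsLipschitzStronglyMonotoneAt m K zs Φ) (hk : 0 < k) (hb₁ : 0 < b₁) (hb₂ : 0 < b₂)
    (hb₃ : 0 ≤ b₃) (hp₁ : p₁ ≤ 1) (hp₂ : 1 ≤ p₂)
    (hN : N ≤ 2 * (k * (b₃ * (1 / ‖Φ x‖ ^ p₃)) * m)) (hx : x ≠ zs) :
    nearRate k b₁ m K p₁ * (‖x - zs‖ ^ 2 / 2) ^ ((1 + p₁) / 2) +
        farRate k b₂ m p₂ * (‖x - zs‖ ^ 2 / 2) ^ ((1 + p₂) / 2) + N * (‖x - zs‖ ^ 2 / 2) ≤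
      -inner ℝ (x - zs) (scaledField (gain k b₁ b₂ b₃ p₁ p₂ p₃) Φ x) := by
  have hv : 0 < ‖x - zs‖ := norm_pos_iff.2 (sub_ne_zero.2 hx)
  have hρ := h.norm_pos hx
  have hnear := nearRate_mul_rpow_le hk.le hb₁.le h.modulus_pos.le K.coe_nonneg hp₁ hv hρ
    (h.norm_le x)
  have hfar := farRate_mul_rpow_le hk.le hb₂.le h.modulus_pos hp₂ hv (h.mul_norm_sub_le x)
  have hlinear := mul_le_mul_of_nonneg_right hN (by positivity : 0 ≤ ‖x - zs‖ ^ 2 / 2)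
  have hgain := gain_pos (p₁ := p₁) (p₂ := p₂) (p₃ := p₃) hk hb₁ hb₂ hb₃ hρ
  rw [neg_inner_scaledField]
  refine le_trans ?_ (mul_le_mul_of_nonneg_left (h.le_inner x) hgain.le)
  unfold gain
  linarith

variable [CompleteSpace H]

theorem isDecaying (h : IsLipschitzStronglyMonotoneAt m K zs Φ) (hk : 0 < k) (hb₁ : 0 < b₁)
    (hb₂ : 0 < b₂) (hb₃ : 0 ≤ b₃) (hp₁ : p₁ ≤ 1) (hp₂ : 1 ≤ p₂)
    (hN : ∀ ρ, 0 < ρ → N ≤ 2 * (k * (b₃ * (1 / ρ ^ p₃)) * m))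
    (hz : IsSolution (scaledField (gain k b₁ b₂ b₃ p₁ p₂ p₃) Φ) z) :
    IsDecaying (fun v => nearRate k b₁ m K p₁ * v ^ ((1 + p₁) / 2) +
      farRate k b₂ m p₂ * v ^ ((1 + p₂) / 2) + N * v) (fun t => ‖z t - zs‖ ^ 2 / 2) :=
  have hf := h.isDissipativeField_scaledField (fun _ => gain_pos hk hb₁ hb₂ hb₃)
    locallyLipschitzOn_gain
  (hf.isIntegralCurveOff hz).isDecaying hf fun _ hx =>
    h.rpow_add_rpow_add_le_neg_inner_scaledField_gain hk hb₁ hb₂ hb₃ hp₁ hp₂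
      (hN _ (h.norm_pos hx)) hx

theorem settlingTime_le (h : IsLipschitzStronglyMonotoneAt m K zs Φ) (hK : 0 < K) (hk : 0 < k)
    (hb₁ : 0 < b₁) (hb₂ : 0 < b₂) (hb₃ : 0 ≤ b₃) (hp₁ : p₁ < 1) (hp₂ : 1 < p₂)
    (hz : IsSolution (scaledField (gain k b₁ b₂ b₃ p₁ p₂ p₃) Φ) z) :
    settlingTime z zs ≤ ENNReal.ofReal
      (1 / (nearRate k b₁ m K p₁ * (1 - (1 + p₁) / 2)) +
        1 / (farRate k b₂ m p₂ * ((1 + p₂) / 2 - 1))) := by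
  have hm := h.modulus_pos
  have hM₁ : 0 < nearRate k b₁ m K p₁ := nearRate_pos hk hb₁ hm hK
  have hM₂ : 0 < farRate k b₂ m p₂ := farRate_pos hk hb₂ hm
  have hr₁ : 0 < 1 - (1 + p₁) / 2 := by linarith
  have hr₂ : 0 < (1 + p₂) / 2 - 1 := by linarith
  have hdecay := h.isDecaying (N := 0) hk hb₁ hb₂ hb₃ hp₁.le hp₂.le (fun _ _ => by positivity) hz
  refine InclusionFlow.settlingTime_le (by positivity) fun t ht => ?_
  have hV := hdecay.eq_zero_of_rpow hM₁ hM₂ (sub_pos.1 hr₁) (sub_pos.1 hr₂)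
    (fun v hv => ?_) (fun v hv => ?_) ht
  · simpa [sub_eq_zero] using hV
  · have : 0 ≤ farRate k b₂ m p₂ * v ^ ((1 + p₂) / 2) := by positivity
    linarith
  · have : 0 ≤ nearRate k b₁ m K p₁ * v ^ ((1 + p₁) / 2) := by positivity
    linarith

theorem settlingTime_le_of_symm (h : IsLipschitzStronglyMonotoneAt m K zs Φ) (hK : 0 < K)
    (hk : 0 < k) (hb₁ : 0 < b₁) (hb₂ : 0 < b₂) (hb₃ : 0 ≤ b₃) (hs : 0 < s)
    (hp₁ : (1 + p₁) / 2 = 1 - s) (hp₂ : (1 + p₂) / 2 = 1 + s)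
    (hz : IsSolution (scaledField (gain k b₁ b₂ b₃ p₁ p₂ p₃) Φ) z) :
    settlingTime z zs ≤ ENNReal.ofReal
      (Real.pi / (2 * s * √(nearRate k b₁ m K p₁ * farRate k b₂ m p₂))) := by
  have hM₁ : 0 < nearRate k b₁ m K p₁ := nearRate_pos hk hb₁ h.modulus_pos hK
  have hM₂ : 0 < farRate k b₂ m p₂ := farRate_pos hk hb₂ h.modulus_pos
  have hdecay := h.isDecaying (N := 0) hk hb₁ hb₂ hb₃ (by linarith) (by linarith)
    (fun _ _ => by have := h.modulus_pos; positivity) hz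
  refine InclusionFlow.settlingTime_le (by positivity) fun t ht => ?_
  simp only [hp₁, hp₂, zero_mul, add_zero] at hdecay
  have hV := hdecay.eq_zero_of_rpow_symm hM₁ hM₂ hs (fun _ _ => le_rfl) ht
  simpa [sub_eq_zero] using hV

theorem apply_eq_of_log_add_log_le (h : IsLipschitzStronglyMonotoneAt m K zs Φ) (hK : 0 < K)
    (hk : 0 < k) (hb₁ : 0 < b₁) (hb₂ : 0 < b₂) (hb₃ : 0 < b₃) (hp₁ : p₁ < 1) (hp₂ : 1 < p₂)
    (hz : IsSolution (scaledField (gain k b₁ b₂ b₃ p₁ p₂ 0) Φ) z)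
    (ht : Real.log (1 + 2 * (k * b₃ * m) / nearRate k b₁ m K p₁) /
          (2 * (k * b₃ * m) * (1 - (1 + p₁) / 2)) +
        Real.log (1 + 2 * (k * b₃ * m) / farRate k b₂ m p₂) /
          (2 * (k * b₃ * m) * ((1 + p₂) / 2 - 1)) ≤ t) : z t = zs := by
  have hm := h.modulus_pos
  have hM₁ : 0 < nearRate k b₁ m K p₁ := nearRate_pos hk hb₁ hm hK
  have hM₂ : 0 < farRate k b₂ m p₂ := farRate_pos hk hb₂ hm
  have hdecay := h.isDecaying (N := 2 * (k * b₃ * m)) hk hb₁ hb₂ hb₃.le hp₁.le hp₂.le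
    (fun _ _ => by rw [Real.rpow_zero, div_one, mul_one]) hz
  have hV := hdecay.eq_zero_of_rpow_linear hM₁ hM₂ (by positivity) (by linarith) (by linarith)
    (fun v hv => ?_) (fun v hv => ?_) ht
  · simpa [sub_eq_zero] using hV
  · have : 0 ≤ farRate k b₂ m p₂ * v ^ ((1 + p₂) / 2) := by positivity
    linarith
  · have : 0 ≤ nearRate k b₁ m K p₁ * v ^ ((1 + p₁) / 2) := by positivity
    linarith

end IsLipschitzStronglyMonotoneAt

end SettlingTime

section PredefinedTime

variable {c b₁ b₂ b₃ p₁ p₂ k : ℝ}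

theorem predefinedGain_pos (hc : 0 ≤ c) (hc1 : c < 1) (hb₁ : 0 < b₁) (hb₂ : 0 < b₂) (hb₃ : 0 < b₃)
    (hp₁ : p₁ < 1) (hp₂ : 1 < p₂) : 0 < predefinedGain c b₁ b₂ b₃ p₁ p₂ := by
  have : 0 < 1 - c := sub_pos.2 hc1
  have : 0 < 1 - p₁ := sub_pos.2 hp₁
  have : 0 < p₂ - 1 := sub_pos.2 hp₂
  have hlog : ∀ x : ℝ, 0 < x → 0 < Real.log (1 + x) := fun x hx =>
    Real.log_pos (lt_add_of_pos_right 1 hx)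
  exact add_pos (mul_pos (by positivity) (hlog _ (by positivity)))
    (mul_pos (by positivity) (hlog _ (by positivity)))

theorem two_div_two_rpow (p : ℝ) : 2 / (2 : ℝ) ^ ((1 + p) / 2) = (2 : ℝ) ^ ((1 - p) / 2) := by
  rw [div_eq_iff (by positivity), ← Real.rpow_add two_pos]
  ring_nf
  exact (Real.rpow_one 2).symm

theorem linear_div_nearRate (hc : -1 < c) (hc1 : c < 1) (hk : k ≠ 0) :
    2 * (k * b₃ * (1 - c)) / nearRate k b₁ (1 - c) (1 + c) p₁ =
      b₃ * (2 : ℝ) ^ ((1 - p₁) / 2) * (1 + c) ^ (1 - p₁) / b₁ := by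
  have hm : 1 - c ≠ 0 := (sub_pos.2 hc1).ne'
  have hK : (1 + c) ^ (1 - p₁) ≠ 0 := (Real.rpow_pos_of_pos (by linarith) _).ne'
  rw [nearRate, ← two_div_two_rpow]
  field_simp

theorem linear_div_farRate (hc1 : c < 1) (hk : k ≠ 0) :
    2 * (k * b₃ * (1 - c)) / farRate k b₂ (1 - c) p₂ =
      b₃ * (2 : ℝ) ^ ((1 - p₂) / 2) * (1 - c) ^ (1 - p₂) / b₂ := by
  have hm : 0 < 1 - c := sub_pos.2 hc1
  have hmp : (1 - c) ^ p₂ ≠ 0 := (Real.rpow_pos_of_pos hm _).ne'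
  rw [farRate, ← two_div_two_rpow, Real.rpow_sub hm, Real.rpow_one]
  field_simp

theorem settling_bound_eq_predefinedGain_div (hc : -1 < c) (hc1 : c < 1) (hk : k ≠ 0) :
    Real.log (1 + 2 * (k * b₃ * (1 - c)) / nearRate k b₁ (1 - c) (1 + c) p₁) /
          (2 * (k * b₃ * (1 - c)) * (1 - (1 + p₁) / 2)) +
        Real.log (1 + 2 * (k * b₃ * (1 - c)) / farRate k b₂ (1 - c) p₂) /
          (2 * (k * b₃ * (1 - c)) * ((1 + p₂) / 2 - 1)) =
      predefinedGain c b₁ b₂ b₃ p₁ p₂ / k := by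
  have hr₁ : 1 - (1 + p₁) / 2 = (1 - p₁) / 2 := by ring
  have hr₂ : (1 + p₂) / 2 - 1 = (p₂ - 1) / 2 := by ring
  rw [linear_div_nearRate hc hc1 hk, linear_div_farRate hc1 hk, hr₁, hr₂, predefinedGain]
  field_simp

end PredefinedTime

section FlowField

variable {H : Type*} [NormedAddCommGroup H] [InnerProductSpace ℝ H] {F : H → Set H} {G : H → H}
  {γ c b₁ b₂ b₃ p₁ p₂ p₃ Kp Tp ζ : ℝ} {zs : H} {z : ℝ → H}

theorem flowField_eq_scaledField :
    flowField F G γ b₁ b₂ b₃ p₁ p₂ p₃ Kp Tp =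
      scaledField (gain (Kp / Tp) b₁ b₂ b₃ p₁ p₂ p₃) (residual F G γ) := by
  funext x
  by_cases hx : residual F G γ x = 0
  · simp [flowField, scaledField, hx]
  · simp [flowField, scaledField, weight, hx, gain]

namespace IsContractionConstant

theorem isDissipativeField_flowField (hc : IsContractionConstant F G γ c)
    (hzs : residual F G γ zs = 0) (hb₁ : 0 < b₁) (hb₂ : 0 < b₂) (hb₃ : 0 ≤ b₃) (hKp : 0 < Kp)
    (hTp : 0 < Tp) : IsDissipativeField zs (flowField F G γ b₁ b₂ b₃ p₁ p₂ p₃ Kp Tp) := by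
  rw [flowField_eq_scaledField]
  exact (hc.isLipschitzStronglyMonotoneAt hzs).isDissipativeField_scaledField
    (fun _ => gain_pos (div_pos hKp hTp) hb₁ hb₂ hb₃) locallyLipschitzOn_gain

theorem flowField_eq_zero_iff (hc : IsContractionConstant F G γ c) (hzs : residual F G γ zs = 0)
    (hb₁ : 0 < b₁) (hb₂ : 0 < b₂) (hb₃ : 0 ≤ b₃) (hKp : 0 < Kp) (hTp : 0 < Tp) (x : H) :
    flowField F G γ b₁ b₂ b₃ p₁ p₂ p₃ Kp Tp x = 0 ↔ x = zs := by
  have hΦ := hc.isLipschitzStronglyMonotoneAt hzs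
  rw [flowField_eq_scaledField, ← hΦ.eq_zero_iff, scaledField, smul_eq_zero, neg_eq_zero]
  refine or_iff_right_of_imp fun hgain => by_contra fun hne => ?_
  exact (gain_pos (div_pos hKp hTp) hb₁ hb₂ hb₃ (norm_pos_iff.2 hne)).ne' hgain

variable [CompleteSpace H]

theorem isWellPosed_flowField (hc : IsContractionConstant F G γ c) (hzs : residual F G γ zs = 0)
    (hb₁ : 0 < b₁) (hb₂ : 0 < b₂) (hb₃ : 0 ≤ b₃) (hKp : 0 < Kp) (hTp : 0 < Tp) :
    IsWellPosed (flowField F G γ b₁ b₂ b₃ p₁ p₂ p₃ Kp Tp) := by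
  rw [flowField_eq_scaledField]
  exact (hc.isLipschitzStronglyMonotoneAt hzs).isWellPosed_scaledField
    (fun _ => gain_pos (div_pos hKp hTp) hb₁ hb₂ hb₃) locallyLipschitzOn_gain

theorem settlingTime_flowField_le (hc : IsContractionConstant F G γ c)
    (hzs : residual F G γ zs = 0) (hb₁ : 0 < b₁) (hb₂ : 0 < b₂) (hb₃ : 0 ≤ b₃) (hp₁ : p₁ < 1)
    (hp₂ : 1 < p₂) (hKp : 0 < Kp) (hTp : 0 < Tp)
    (hz : IsSolution (flowField F G γ b₁ b₂ b₃ p₁ p₂ p₃ Kp Tp) z) :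
    settlingTime z zs ≤ ENNReal.ofReal
      (1 / (nearRate (Kp / Tp) b₁ (1 - c) (1 + c) p₁ * (1 - (1 + p₁) / 2)) +
        1 / (farRate (Kp / Tp) b₂ (1 - c) p₂ * ((1 + p₂) / 2 - 1))) := by
  rw [flowField_eq_scaledField] at hz
  exact (hc.isLipschitzStronglyMonotoneAt hzs).settlingTime_le (by positivity) (div_pos hKp hTp)
    hb₁ hb₂ hb₃ hp₁ hp₂ hz

theorem settlingTime_flowField_le_of_symm (hc : IsContractionConstant F G γ c)
    (hzs : residual F G γ zs = 0) (hb₁ : 0 < b₁) (hb₂ : 0 < b₂) (hb₃ : 0 ≤ b₃) (hKp : 0 < Kp)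
    (hTp : 0 < Tp) (hζ : 0 < ζ) (hp₁ : (1 + p₁) / 2 = 1 - 1 / (2 * ζ))
    (hp₂ : (1 + p₂) / 2 = 1 + 1 / (2 * ζ))
    (hz : IsSolution (flowField F G γ b₁ b₂ b₃ p₁ p₂ p₃ Kp Tp) z) :
    settlingTime z zs ≤ ENNReal.ofReal (Real.pi * ζ /
      √(nearRate (Kp / Tp) b₁ (1 - c) (1 + c) p₁ * farRate (Kp / Tp) b₂ (1 - c) p₂)) := by
  have hζs : Real.pi * ζ = Real.pi / (2 * (1 / (2 * ζ))) := by field_simp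
  rw [flowField_eq_scaledField] at hz
  rw [hζs, div_div]
  exact (hc.isLipschitzStronglyMonotoneAt hzs).settlingTime_le_of_symm (by positivity)
    (div_pos hKp hTp) hb₁ hb₂ hb₃ (by positivity) hp₁ hp₂ hz

theorem apply_eq_of_predefinedGain (hc : IsContractionConstant F G γ c)
    (hzs : residual F G γ zs = 0) (hb₁ : 0 < b₁) (hb₂ : 0 < b₂) (hb₃ : 0 < b₃) (hp₁ : p₁ < 1)
    (hp₂ : 1 < p₂) (hTp : 0 < Tp)
    (hz : IsSolution
      (flowField F G γ b₁ b₂ b₃ p₁ p₂ 0 (predefinedGain c b₁ b₂ b₃ p₁ p₂) Tp) z)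
    {t : ℝ} (ht : Tp ≤ t) : z t = zs := by
  have hgain := predefinedGain_pos hc.1.le hc.2.1 hb₁ hb₂ hb₃ hp₁ hp₂
  have hk : 0 < predefinedGain c b₁ b₂ b₃ p₁ p₂ / Tp := div_pos hgain hTp
  have hbound := settling_bound_eq_predefinedGain_div (b₁ := b₁) (b₂ := b₂) (b₃ := b₃) (p₁ := p₁)
    (p₂ := p₂) (neg_one_lt_zero.trans hc.1) hc.2.1 hk.ne'
  rw [div_div_cancel₀ hgain.ne'] at hbound
  rw [flowField_eq_scaledField] at hz
  exact (hc.isLipschitzStronglyMonotoneAt hzs).apply_eq_of_log_add_log_le (by positivity) hk hb₁ hb₂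
    hb₃ hp₁ hp₂ hz (hbound.trans_le ht)

end IsContractionConstant

end FlowField

theorem mainTheorem1_general {H : Type*} [NormedAddCommGroup H] [InnerProductSpace ℝ H]
    [CompleteSpace H] (F : H → Set H) (G : H → H) (ηF ηG γ : ℝ) (L : ℝ≥0)
    (hF : IsMaximalMonotoneWith ηF F)
    (hG : IsMonotoneWith ηG (fun z => {G z}))
    (hGL : LipschitzWith L G)
    (hγ : 0 < γ)
    (hγF : 0 < 1 + γ * ηF)
    (hA : 0 < 2 * (ηF + ηG) + γ * ηF ^ 2 - γ * (L : ℝ) ^ 2) :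
    (∀ x : H, ∃! y : H, y ∈ resolventVal F γ x) ∧
    (∃ c : ℝ, IsContractionConstant F G γ c) ∧
    ∃ zs : H, (∀ z : H, SolvesInclusion F G z ↔ z = zs) ∧
      ∀ b₁ b₂ b₃ p₁ p₂ : ℝ, 0 < b₁ → 0 < b₂ → p₁ < 1 → 1 < p₂ →
        (0 ≤ b₃ → ∀ p₃ Kp Tp : ℝ, 0 < Kp → 0 < Tp →
          (∀ z : H, flowField F G γ b₁ b₂ b₃ p₁ p₂ p₃ Kp Tp z = 0 ↔ z = zs) ∧
          IsWellPosed (flowField F G γ b₁ b₂ b₃ p₁ p₂ p₃ Kp Tp) ∧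
          IsGloballyFixedTimeStable (flowField F G γ b₁ b₂ b₃ p₁ p₂ p₃ Kp Tp) zs ∧
          ∀ c : ℝ, IsContractionConstant F G γ c →
            ∀ z : ℝ → H, IsSolution (flowField F G γ b₁ b₂ b₃ p₁ p₂ p₃ Kp Tp) z →
              settlingTime z zs ≤ ENNReal.ofReal
                (1 / (nearRate (Kp / Tp) b₁ (1 - c) (1 + c) p₁ * (1 - (1 + p₁) / 2)) +
                  1 / (farRate (Kp / Tp) b₂ (1 - c) p₂ * ((1 + p₂) / 2 - 1))) ∧
              ∀ ζ : ℝ, 0 < ζ → (1 + p₁) / 2 = 1 - 1 / (2 * ζ) → (1 + p₂) / 2 = 1 + 1 / (2 * ζ) →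
                settlingTime z zs ≤ ENNReal.ofReal (Real.pi * ζ /
                  √(nearRate (Kp / Tp) b₁ (1 - c) (1 + c) p₁ *
                    farRate (Kp / Tp) b₂ (1 - c) p₂))) ∧
        (0 < b₃ → ∀ c : ℝ, IsContractionConstant F G γ c →
          0 < predefinedGain c b₁ b₂ b₃ p₁ p₂ ∧
          ∀ Tp : ℝ, 0 < Tp → ∀ z : ℝ → H,
            IsSolution
              (flowField F G γ b₁ b₂ b₃ p₁ p₂ 0 (predefinedGain c b₁ b₂ b₃ p₁ p₂) Tp) z →
            settlingTime z zs ≤ ENNReal.ofReal Tp ∧ ∀ t : ℝ, Tp ≤ t → z t = zs) := by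
  obtain ⟨c₀, hc₀⟩ := exists_isContractionConstant hF hG hGL hγ hγF hA
  obtain ⟨zs, hzs⟩ := hc₀.exists_residual_eq_zero
  refine ⟨hF.existsUnique_mem_resolventVal hγ hγF, ⟨c₀, hc₀⟩, zs, fun z => ?_,
    fun b₁ b₂ b₃ p₁ p₂ hb₁ hb₂ hp₁ hp₂ => ⟨fun hb₃ p₃ Kp Tp hKp hTp => ?_, fun hb₃ c hc => ?_⟩⟩
  · rw [hF.solvesInclusion_iff_residual_eq_zero hγ hγF,
      (hc₀.isLipschitzStronglyMonotoneAt hzs).eq_zero_iff]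
  · refine ⟨hc₀.flowField_eq_zero_iff hzs hb₁ hb₂ hb₃ hKp hTp,
      hc₀.isWellPosed_flowField hzs hb₁ hb₂ hb₃ hKp hTp,
      (hc₀.isDissipativeField_flowField hzs hb₁ hb₂ hb₃ hKp hTp).isGloballyFixedTimeStable
        fun z hz => hc₀.settlingTime_flowField_le hzs hb₁ hb₂ hb₃ hp₁ hp₂ hKp hTp hz,
      fun c hc z hz => ⟨hc.settlingTime_flowField_le hzs hb₁ hb₂ hb₃ hp₁ hp₂ hKp hTp hz,
        fun ζ hζ hr₁ hr₂ =>
          hc.settlingTime_flowField_le_of_symm hzs hb₁ hb₂ hb₃ hKp hTp hζ hr₁ hr₂ hz⟩⟩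
  · have hsettled : ∀ Tp, 0 < Tp → ∀ z, IsSolution
        (flowField F G γ b₁ b₂ b₃ p₁ p₂ 0 (predefinedGain c b₁ b₂ b₃ p₁ p₂) Tp) z →
        ∀ t, Tp ≤ t → z t = zs := fun Tp hTp z hz t ht =>
      hc.apply_eq_of_predefinedGain hzs hb₁ hb₂ hb₃ hp₁ hp₂ hTp hz ht
    exact ⟨predefinedGain_pos hc.1.le hc.2.1 hb₁ hb₂ hb₃ hp₁ hp₂, fun Tp hTp z hz =>
      ⟨settlingTime_le hTp.le (hsettled Tp hTp z hz), hsettled Tp hTp z hz⟩⟩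

end InclusionFlow

theorem mainTheorem1 {H : Type*} [NormedAddCommGroup H] [InnerProductSpace ℝ H]
    [FiniteDimensional ℝ H] (F : H → Set H) (G : H → H) (ηF ηG γ : ℝ) (L : ℝ≥0)
    (hF : IsMaximalMonotoneWith ηF F)
    (hG : IsMonotoneWith ηG (fun z => {G z}))
    (hGL : LipschitzWith L G)
    (hγ : 0 < γ)
    (hγF : 0 < 1 + γ * ηF)
    (hA : 0 < 2 * (ηF + ηG) + γ * ηF ^ 2 - γ * (L : ℝ) ^ 2) :
    -- the resolvent is everywhere defined and single-valued
    (∀ x : H, ∃! y : H, y ∈ resolventVal F γ x) ∧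
    -- the forward-backward operator has a Lipschitz constant in (0,1)
    (∃ c : ℝ, IsContractionConstant F G γ c) ∧
    ∃ zs : H, (∀ z : H, SolvesInclusion F G z ↔ z = zs) ∧
      ∀ b₁ b₂ b₃ p₁ p₂ : ℝ, 0 < b₁ → 0 < b₂ → 0 < b₃ → 0 < p₁ → p₁ < 1 → 1 < p₂ →
        -- fixed-time stability and settling-time estimates
        (∀ p₃ Kp Tp : ℝ, 0 ≤ p₃ → 0 < Kp → 0 < Tp →
          (∀ z : H, flowField F G γ b₁ b₂ b₃ p₁ p₂ p₃ Kp Tp z = 0 ↔ z = zs) ∧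
          IsWellPosed (flowField F G γ b₁ b₂ b₃ p₁ p₂ p₃ Kp Tp) ∧
          IsGloballyFixedTimeStable (flowField F G γ b₁ b₂ b₃ p₁ p₂ p₃ Kp Tp) zs ∧
          ∀ c : ℝ, IsContractionConstant F G γ c →
            ∃ M₁ M₂ r₁ r₂ : ℝ, 0 < M₁ ∧ 0 < M₂ ∧ 1 / 2 < r₁ ∧ r₁ < 1 ∧ 1 < r₂ ∧
              r₁ = (1 + p₁) / 2 ∧ r₂ = (1 + p₂) / 2 ∧
              M₁ = (2 : ℝ) ^ ((1 + p₁) / 2) * (Kp / Tp) *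
                (b₁ * (1 - c) / (1 + c) ^ (1 - p₁)) ∧
              M₂ = (2 : ℝ) ^ ((1 + p₂) / 2) * (Kp / Tp) * ((1 - c) ^ p₂ * b₂) ∧
              ∀ z : ℝ → H, IsSolution (flowField F G γ b₁ b₂ b₃ p₁ p₂ p₃ Kp Tp) z →
                settlingTime z zs ≤
                  ENNReal.ofReal (1 / (M₁ * (1 - r₁)) + 1 / (M₂ * (r₂ - 1))) ∧
                ∀ ζ : ℝ, 1 < ζ → r₁ = 1 - 1 / (2 * ζ) → r₂ = 1 + 1 / (2 * ζ) →
                  settlingTime z zs ≤ ENNReal.ofReal (Real.pi * ζ / Real.sqrt (M₁ * M₂))) ∧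
        -- predefined-time convergence when `p₃ = 0`
        (∀ c : ℝ, IsContractionConstant F G γ c →
          0 < predefinedGain c b₁ b₂ b₃ p₁ p₂ ∧
          ∀ Tp : ℝ, 0 < Tp → ∀ z : ℝ → H,
            IsSolution
              (flowField F G γ b₁ b₂ b₃ p₁ p₂ 0 (predefinedGain c b₁ b₂ b₃ p₁ p₂) Tp) z →
            settlingTime z zs ≤ ENNReal.ofReal Tp ∧ ∀ t : ℝ, Tp ≤ t → z t = zs) := by
  have := FiniteDimensional.complete ℝ H
  obtain ⟨hJ, hB, zs, hzs, hflow⟩ := mainTheorem1_general F G ηF ηG γ L hF hG hGL hγ hγF hA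
  refine ⟨hJ, hB, zs, hzs, fun b₁ b₂ b₃ p₁ p₂ hb₁ hb₂ hb₃ hp₁0 hp₁ hp₂ => ?_⟩
  obtain ⟨hfixed, hpredefined⟩ := hflow b₁ b₂ b₃ p₁ p₂ hb₁ hb₂ hp₁ hp₂
  refine ⟨fun p₃ Kp Tp _ hKp hTp => ?_, hpredefined hb₃⟩
  obtain ⟨heq, hwell, hstable, hsettling⟩ := hfixed hb₃.le p₃ Kp Tp hKp hTp
  refine ⟨heq, hwell, hstable, fun c hc => ⟨nearRate (Kp / Tp) b₁ (1 - c) (1 + c) p₁,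
    farRate (Kp / Tp) b₂ (1 - c) p₂, (1 + p₁) / 2, (1 + p₂) / 2,
    nearRate_pos (div_pos hKp hTp) hb₁ (sub_pos.2 hc.2.1) (add_pos one_pos hc.1),
    farRate_pos (div_pos hKp hTp) hb₂ (sub_pos.2 hc.2.1), by linarith, by linarith, by linarith,
    rfl, rfl, rfl, rfl, fun z hz => ?_⟩⟩
  exact (hsettling c hc z hz).imp_right fun h ζ hζ => h ζ (one_pos.trans hζ)
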